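/- All monoidal categories are strict, and all functors between them are strict. A $\dagger$-symmetric monoidal category ($\dagger$-SMC) is a symmetric monoidal category with an identity-on-objects, involutive, contravariant symmetric monoidal functor $(\cdot)^\dagger$. It is $\dagger$-compact if every object $A$ has a dual $A^*$ with morphisms $\varepsilon_A:A\otimes A^*\to I$ and $\eta_A:I\to A^*\otimes A$ that satisfy the snake equations and $\varepsilon_A^\dagger=\sigma_{A^*,A}\circ\eta_A$. A morphism $u:A\to B$ is an isometry if $u^\dagger\circ u=1_A$. Let $f:A\to B\otimes X$ and $g:A\to B\otimes Y$ be morphisms of a $\dagger$-SMC. Write $f\sim_{\mathrm{iso}}g$ if there are isometries $u:X\to Z$ and $v:Y\to Z$ with $(1_B\otimes u)\circ f=(1_B\otimes v)\circ g$. Write $f\sim_{cp}g$ if $$(1_B\otimes f^\dagger)\circ(\sigma_{B,B}\otimes 1_X)\circ(1_B\otimes f)=(1_B\otimes g^\dagger)\circ(\sigma_{B,B}\otimes 1_Y)\circ(1_B\otimes g)$$ as morphisms $B\otimes A\to B\otimes A$. The category has enough isometries if $\sim_{cp}$ is equal to the transitive closure of $\sim_{\mathrm{iso}}$. For a $\dagger$-compact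 category $\mathbf C$, the symmetric monoidal category $\operatorname{CPM}(\mathbf C)$ has the objects of $\mathbf C$. Its morphisms $A\to B$ are the morphisms $A\otimes A^*\to B\otimes B^*$ of $\mathbf C$ obtained from $f\otimes f_*$, for some $f:A\to B\otimes X$, by joining the wires $X$ and $X^*$; here $f_*:A^*\to X^*\otimes B^*$ is the dual of $f^\dagger$. Composition is that of $\mathbf C$, and the tensor product and the symmetry are induced by those of $\mathbf C$. The discard map $A\to I$ of $\operatorname{CPM}(\mathbf C)$ is the one given by $f=1_A:A\to I\otimes A$. A graphical language $\mathcal G$ for a symmetric monoidal category $\mathbf S$ is a prop presented by generators $\Sigma$ (each with numbers of inputs and outputs) and equations $E$, with an interpretation in $\mathbf S$: an object $X$ of $\mathbf S$ and, for each generator $n\to m$, a morphism $X^{\otimes n}\to X^{\otimes m}$. It is sound if the equations hold in $\mathbf S$, so that the interpretation extends to a symmetric monoidal functor $[\![\cdot]\!]:\mathcal G\to\mathbf S$. A sound language is universal if this functor is surjective, on objects and on each hom-set, and complete if it is faithful. Corollary. Let $\mathbf C$ be a $\dagger$-compact category with enough isometries. Let $\mathcal G$ be a sound, universal and complete graphical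 language for $\mathbf C$ such that $\mathcal G$ is a $\dagger$-compact category and $[\![\cdot]\!]$ preserves the dagger. Let $\mathcal G^{⏚}$ be the prop presented by the generators of $\mathcal G$ and one more generator $⏚:1\to 0$, and by the equations of $\mathcal G$ and the equation $⏚^{\otimes m}\circ D=⏚^{\otimes n}$ for each isometry $D:n\to m$ of $\mathcal G$. Interpret $\mathcal G^{⏚}$ in $\operatorname{CPM}(\mathbf C)$ by sending the wire to $X$, each generator $s$ of $\mathcal G$ to $[\![s]\!]\otimes[\![s]\!]_*$, and $⏚$ to the discard map of $X$. Then $\mathcal G^{⏚}$ is sound, universal and complete for $\operatorname{CPM}(\mathbf C)$. -/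

import Mathlib

open CategoryTheory MonoidalCategory

universe w v u v' u'

/-- A strict monoidal category. -/
class StrictMonoidal (C : Type u) [Category.{v} C] [MonoidalCategory C] : Prop where
  tensor_assoc : ∀ X Y Z : C, (X ⊗ Y) ⊗ Z = X ⊗ (Y ⊗ Z)
  unit_tensor : ∀ X : C, 𝟙_ C ⊗ X = X
  tensor_unit : ∀ X : C, X ⊗ 𝟙_ C = X
  associator_hom : ∀ X Y Z : C, (α_ X Y Z).hom = eqToHom (tensor_assoc X Y Z)
  leftUnitor_hom : ∀ X : C, (λ_ X).hom = eqToHom (unit_tensor X)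
  rightUnitor_hom : ∀ X : C, (ρ_ X).hom = eqToHom (tensor_unit X)

section StrictBasics

theorem StrictMonoidal.associator_inv {C : Type u} [Category.{v} C] [MonoidalCategory C]
    [StrictMonoidal C] (X Y Z : C) :
    (α_ X Y Z).inv = eqToHom (StrictMonoidal.tensor_assoc X Y Z).symm := by
  rw [← cancel_epi (α_ X Y Z).hom, Iso.hom_inv_id, StrictMonoidal.associator_hom]; simp

theorem StrictMonoidal.leftUnitor_inv {C : Type u} [Category.{v} C] [MonoidalCategory C]
    [StrictMonoidal C] (X : C) : (λ_ X).inv = eqToHom (StrictMonoidal.unit_tensor X).symm := by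
  rw [← cancel_epi (λ_ X).hom, Iso.hom_inv_id, StrictMonoidal.leftUnitor_hom]; simp

theorem StrictMonoidal.rightUnitor_inv {C : Type u} [Category.{v} C] [MonoidalCategory C]
    [StrictMonoidal C] (X : C) : (ρ_ X).inv = eqToHom (StrictMonoidal.tensor_unit X).symm := by
  rw [← cancel_epi (ρ_ X).hom, Iso.hom_inv_id, StrictMonoidal.rightUnitor_hom]; simp

theorem eqToHom_tensorHom_eqToHom {C : Type u} [Category.{v} C] [MonoidalCategory C]
    {A B A' B' : C} (h : A = B) (h' : A' = B') :
    eqToHom h ⊗ₘ eqToHom h' = eqToHom (by rw [h, h']) := by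
  subst h; subst h'; simp

theorem eqToHom_whiskerRight' {C : Type u} [Category.{v} C] [MonoidalCategory C]
    {A B : C} (h : A = B) (Z : C) :
    eqToHom h ▷ Z = eqToHom (by rw [h]) := by
  subst h; simp

theorem whiskerLeft_eqToHom' {C : Type u} [Category.{v} C] [MonoidalCategory C]
    {A B : C} (h : A = B) (Z : C) :
    Z ◁ eqToHom h = eqToHom (by rw [h]) := by
  subst h; simp

theorem StrictMonoidal.tensorHom_assoc {C : Type u} [Category.{v} C] [MonoidalCategory C]
    [StrictMonoidal C] {A B A' B' A'' B'' : C} (f : A ⟶ B) (g : A' ⟶ B') (h : A'' ⟶ B'') :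
    (f ⊗ₘ g) ⊗ₘ h = eqToHom (StrictMonoidal.tensor_assoc A A' A'') ≫ (f ⊗ₘ (g ⊗ₘ h)) ≫
      eqToHom (StrictMonoidal.tensor_assoc B B' B'').symm := by
  have h1 := MonoidalCategory.associator_naturality f g h
  rw [StrictMonoidal.associator_hom, StrictMonoidal.associator_hom] at h1
  rw [← Category.assoc, ← h1]
  simp

theorem StrictMonoidal.unit_tensorHom {C : Type u} [Category.{v} C] [MonoidalCategory C]
    [StrictMonoidal C] {A B : C} (f : A ⟶ B) :
    𝟙 (𝟙_ C) ⊗ₘ f = eqToHom (StrictMonoidal.unit_tensor A) ≫ f ≫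
      eqToHom (StrictMonoidal.unit_tensor B).symm := by
  have h1 := MonoidalCategory.leftUnitor_naturality f
  rw [StrictMonoidal.leftUnitor_hom, StrictMonoidal.leftUnitor_hom] at h1
  rw [← Category.assoc, ← h1]
  simp

theorem StrictMonoidal.tensorHom_unit {C : Type u} [Category.{v} C] [MonoidalCategory C]
    [StrictMonoidal C] {A B : C} (f : A ⟶ B) :
    f ⊗ₘ 𝟙 (𝟙_ C) = eqToHom (StrictMonoidal.tensor_unit A) ≫ f ≫
      eqToHom (StrictMonoidal.tensor_unit B).symm := by
  have h1 := MonoidalCategory.rightUnitor_naturality f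
  rw [StrictMonoidal.rightUnitor_hom, StrictMonoidal.rightUnitor_hom] at h1
  rw [← Category.assoc, ← h1]
  simp

end StrictBasics

/-- `X^{⊗ n}` in a monoidal category. -/
def tensorPow {C : Type u} [Category.{v} C] [MonoidalCategory C] (X : C) : ℕ → C
  | 0 => 𝟙_ C
  | n + 1 => tensorPow X n ⊗ X

theorem tensorPow_one {C : Type u} [Category.{v} C] [MonoidalCategory C] [StrictMonoidal C]
    (X : C) : tensorPow X 1 = X :=
  StrictMonoidal.unit_tensor X

theorem tensorPow_add {C : Type u} [Category.{v} C] [MonoidalCategory C] [StrictMonoidal C]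
    (X : C) (m n : ℕ) : tensorPow X (m + n) = tensorPow X m ⊗ tensorPow X n := by
  induction n with
  | zero => exact (StrictMonoidal.tensor_unit _).symm
  | succ n ih =>
    change tensorPow X (m + n) ⊗ X = tensorPow X m ⊗ (tensorPow X n ⊗ X)
    rw [ih, StrictMonoidal.tensor_assoc]

/-- Formal diagrams over a signature `Gen`, where `Gen n m` is the set of generators with `n` inputs
and `m` outputs. -/
inductive Diagram (Gen : ℕ → ℕ → Type w) : ℕ → ℕ → Type w
  | gen {n m : ℕ} (s : Gen n m) : Diagram Gen n m
  | id (n : ℕ) : Diagram Gen n n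
  | comp {n m k : ℕ} (f : Diagram Gen n m) (g : Diagram Gen m k) : Diagram Gen n k
  | tensor {n m n' m' : ℕ} (f : Diagram Gen n m) (g : Diagram Gen n' m') :
      Diagram Gen (n + n') (m + m')
  | swap (n m : ℕ) : Diagram Gen (n + m) (m + n)

namespace Diagram

/-- Transport of a diagram along equalities between its numbers of inputs and outputs. -/
def cast {Gen : ℕ → ℕ → Type w} {n m n' m' : ℕ} (h : n = n') (h' : m = m')
    (f : Diagram Gen n m) : Diagram Gen n' m' :=
  h ▸ h' ▸ f

/-- Equality of diagrams in the prop presented by the equations `E`: the smallest congruence that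
contains `E` and the axioms of strict symmetric monoidal categories. -/
inductive Equiv {Gen : ℕ → ℕ → Type w} (E : ∀ n m : ℕ, Diagram Gen n m → Diagram Gen n m → Prop) :
    ∀ {n m : ℕ}, Diagram Gen n m → Diagram Gen n m → Prop
  | eqn {n m : ℕ} {f g : Diagram Gen n m} (h : E n m f g) : Equiv E f g
  | refl {n m : ℕ} (f : Diagram Gen n m) : Equiv E f f
  | symm {n m : ℕ} {f g : Diagram Gen n m} (h : Equiv E f g) : Equiv E g f
  | trans {n m : ℕ} {f g k : Diagram Gen n m} (h : Equiv E f g) (h' : Equiv E g k) : Equiv E f k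
  | comp_congr {n m k : ℕ} {f f' : Diagram Gen n m} {g g' : Diagram Gen m k}
      (h : Equiv E f f') (h' : Equiv E g g') : Equiv E (f.comp g) (f'.comp g')
  | tensor_congr {n m n' m' : ℕ} {f f' : Diagram Gen n m} {g g' : Diagram Gen n' m'}
      (h : Equiv E f f') (h' : Equiv E g g') : Equiv E (f.tensor g) (f'.tensor g')
  | id_comp {n m : ℕ} (f : Diagram Gen n m) : Equiv E ((id n).comp f) f
  | comp_id {n m : ℕ} (f : Diagram Gen n m) : Equiv E (f.comp (id m)) f
  | assoc {n m k l : ℕ} (f : Diagram Gen n m) (g : Diagram Gen m k) (h : Diagram Gen k l) :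
      Equiv E ((f.comp g).comp h) (f.comp (g.comp h))
  | tensor_id (n m : ℕ) : Equiv E ((id n).tensor (id m)) (id (n + m))
  | interchange {n m k n' m' k' : ℕ} (f : Diagram Gen n m) (g : Diagram Gen m k)
      (f' : Diagram Gen n' m') (g' : Diagram Gen m' k') :
      Equiv E ((f.comp g).tensor (f'.comp g')) ((f.tensor f').comp (g.tensor g'))
  | tensor_assoc {n m n' m' n'' m'' : ℕ} (f : Diagram Gen n m) (g : Diagram Gen n' m')
      (h : Diagram Gen n'' m'') :
      Equiv E ((f.tensor g).tensor h)
        (cast (Nat.add_assoc _ _ _).symm (Nat.add_assoc _ _ _).symm (f.tensor (g.tensor h)))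
  | unit_tensor {n m : ℕ} (f : Diagram Gen n m) :
      Equiv E ((id 0).tensor f) (cast (Nat.zero_add _).symm (Nat.zero_add _).symm f)
  | tensor_unit {n m : ℕ} (f : Diagram Gen n m) :
      Equiv E (f.tensor (id 0)) (cast (Nat.add_zero _).symm (Nat.add_zero _).symm f)
  | swap_naturality {n m n' m' : ℕ} (f : Diagram Gen n m) (g : Diagram Gen n' m') :
      Equiv E ((f.tensor g).comp (swap m m')) ((swap n n').comp (g.tensor f))
  | swap_swap (n m : ℕ) : Equiv E ((swap n m).comp (swap m n)) (id (n + m))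
  | swap_unit (n : ℕ) : Equiv E (swap n 0) (cast rfl (Nat.zero_add n).symm (id n))
  | swap_add (n m k : ℕ) :
      Equiv E (swap n (m + k))
        (((cast (Nat.add_assoc n m k) (Nat.add_assoc m n k) ((swap n m).tensor (id k))).comp
          (cast rfl (Nat.add_assoc m k n).symm ((id m).tensor (swap n k)))))

/-- The value of a diagram in a strict symmetric monoidal category, when the wire is interpreted as
the object `X` and the generators as the morphisms `I`. -/
def eval {Gen : ℕ → ℕ → Type w} {C : Type u} [Category.{v} C] [MonoidalCategory C]
    [SymmetricCategory C] [StrictMonoidal C] (X : C)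
    (I : ∀ n m : ℕ, Gen n m → (tensorPow X n ⟶ tensorPow X m)) :
    ∀ {n m : ℕ}, Diagram Gen n m → (tensorPow X n ⟶ tensorPow X m)
  | _, _, gen s => I _ _ s
  | _, _, id n => 𝟙 (tensorPow X n)
  | _, _, comp f g => eval X I f ≫ eval X I g
  | _, _, @tensor _ n m n' m' f g =>
      eqToHom (tensorPow_add X n n') ≫ (eval X I f ⊗ₘ eval X I g) ≫
        eqToHom (tensorPow_add X m m').symm
  | _, _, swap n m =>
      eqToHom (tensorPow_add X n m) ≫ (β_ (tensorPow X n) (tensorPow X m)).hom ≫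
        eqToHom (tensorPow_add X m n).symm

theorem eval_cast {Gen : ℕ → ℕ → Type w} {C : Type u} [Category.{v} C] [MonoidalCategory C]
    [SymmetricCategory C] [StrictMonoidal C] (X : C)
    (I : ∀ n m : ℕ, Gen n m → (tensorPow X n ⟶ tensorPow X m))
    {n m n' m' : ℕ} (h : n = n') (h' : m = m') (f : Diagram Gen n m) :
    eval X I (cast h h' f) = eqToHom (by rw [h]) ≫ eval X I f ≫ eqToHom (by rw [h']) := by
  subst h; subst h'; simp [cast]

theorem eval_eq_of_equiv {Gen : ℕ → ℕ → Type w}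
    {E : ∀ n m : ℕ, Diagram Gen n m → Diagram Gen n m → Prop}
    {C : Type u} [Category.{v} C] [MonoidalCategory C]
    [SymmetricCategory C] [StrictMonoidal C] (X : C)
    (I : ∀ n m : ℕ, Gen n m → (tensorPow X n ⟶ tensorPow X m))
    (hE : ∀ (n m : ℕ) (f g : Diagram Gen n m), E n m f g → eval X I f = eval X I g)
    {n m : ℕ} {f g : Diagram Gen n m} (h : Equiv E f g) : eval X I f = eval X I g := by
  induction h with
  | eqn h => exact hE _ _ _ _ h
  | refl f => rfl
  | symm h ih => exact ih.symm
  | trans h h' ih ih' => exact ih.trans ih'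
  | comp_congr h h' ih ih' => simp only [eval, ih, ih']
  | tensor_congr h h' ih ih' => simp only [eval, ih, ih']
  | id_comp f => simp [eval]
  | comp_id f => simp [eval]
  | assoc f g h => simp [eval]
  | tensor_id n m => simp [eval]
  | interchange f g f' g' => simp [eval]
  | @tensor_assoc n m n' m' n'' m'' f g h =>
    rw [eval_cast]
    simp only [eval]
    rw [show eval X I h = eqToHom rfl ≫ eval X I h ≫ eqToHom rfl by simp,
      ← tensorHom_comp_tensorHom, ← tensorHom_comp_tensorHom,
      StrictMonoidal.tensorHom_assoc]
    rw [show eval X I f ⊗ₘ (eqToHom (tensorPow_add X n' n'') ≫ (eval X I g ⊗ₘ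
        (eqToHom rfl ≫ eval X I h ≫ eqToHom rfl)) ≫
        eqToHom (tensorPow_add X m' m'').symm) =
        (eqToHom rfl ≫ eval X I f ≫ eqToHom rfl) ⊗ₘ
        (eqToHom (tensorPow_add X n' n'') ≫ (eval X I g ⊗ₘ eval X I h) ≫
        eqToHom (tensorPow_add X m' m'').symm) by simp,
      ← tensorHom_comp_tensorHom, ← tensorHom_comp_tensorHom]
    simp only [eqToHom_tensorHom_eqToHom, Category.assoc, eqToHom_trans, eqToHom_trans_assoc]
  | @unit_tensor n m f =>
    have key : 𝟙 (tensorPow X 0) ⊗ₘ eval X I f =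
        eqToHom (show tensorPow X 0 ⊗ tensorPow X n = tensorPow X n from
          StrictMonoidal.unit_tensor _) ≫ eval X I f ≫
        eqToHom (show tensorPow X m = tensorPow X 0 ⊗ tensorPow X m from
          (StrictMonoidal.unit_tensor _).symm) := StrictMonoidal.unit_tensorHom _
    simp only [eval_cast, eval, key, Category.assoc, eqToHom_trans, eqToHom_trans_assoc]
  | @tensor_unit n m f =>
    have key : eval X I f ⊗ₘ 𝟙 (tensorPow X 0) =
        eqToHom (show tensorPow X n ⊗ tensorPow X 0 = tensorPow X n from
          StrictMonoidal.tensor_unit _) ≫ eval X I f ≫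
        eqToHom (show tensorPow X m = tensorPow X m ⊗ tensorPow X 0 from
          (StrictMonoidal.tensor_unit _).symm) := StrictMonoidal.tensorHom_unit _
    simp only [eval_cast, eval, key, Category.assoc, eqToHom_trans, eqToHom_trans_assoc]
  | swap_naturality f g => simp [eval]
  | swap_swap n m => simp [eval]
  | swap_unit n =>
    have key : (β_ (tensorPow X n) (tensorPow X 0)).hom =
        eqToHom (show tensorPow X n ⊗ tensorPow X 0 = tensorPow X 0 ⊗ tensorPow X n from
          (StrictMonoidal.tensor_unit _).trans (StrictMonoidal.unit_tensor _).symm) := by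
      refine (braiding_tensorUnit_right (tensorPow X n)).trans ?_
      rw [StrictMonoidal.rightUnitor_hom, StrictMonoidal.leftUnitor_inv, eqToHom_trans]
      rfl
    simp only [eval_cast, eval, key, Category.id_comp, eqToHom_trans]
  | swap_add n m k =>
    have h1 := BraidedCategory.hexagon_forward (tensorPow X n) (tensorPow X m) (tensorPow X k)
    have h2 : ∀ {A B B' : C} (h : B = B'), (β_ A B).hom =
        eqToHom (by rw [h]) ≫ (β_ A B').hom ≫ eqToHom (by rw [h]) := by
      intro A B B' h; subst h; simp
    simp only [StrictMonoidal.associator_hom] at h1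
    have h3 : (β_ (tensorPow X n) (tensorPow X m ⊗ tensorPow X k)).hom =
        eqToHom (StrictMonoidal.tensor_assoc _ _ _).symm ≫
          ((β_ (tensorPow X n) (tensorPow X m)).hom ▷ tensorPow X k ≫
          eqToHom (StrictMonoidal.tensor_assoc _ _ _) ≫
          tensorPow X m ◁ (β_ (tensorPow X n) (tensorPow X k)).hom) ≫
        eqToHom (StrictMonoidal.tensor_assoc _ _ _).symm := by
      rw [← h1]; simp
    simp only [eval, eval_cast, tensorHom_id, id_tensorHom, comp_whiskerRight, whiskerLeft_comp,
      eqToHom_whiskerRight', whiskerLeft_eqToHom', h2 (tensorPow_add X m k), h3, Category.assoc,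
      eqToHom_trans, eqToHom_trans_assoc]

end Diagram

/-- A presentation of a prop by generators and equations. -/
structure PropPresentation where
  /-- generators, with their numbers of inputs and outputs -/
  Gen : ℕ → ℕ → Type w
  /-- equations between parallel diagrams -/
  Eqn : ∀ n m : ℕ, Diagram Gen n m → Diagram Gen n m → Prop

namespace PropPresentation

/-- The set of objects of the presented prop: the natural numbers. -/
@[ext]
structure Carrier (P : PropPresentation.{w}) where
  /-- the number of wires -/
  width : ℕ

/-- Diagrams up to the equations of the presentation and the axioms of props. -/
def homSetoid (P : PropPresentation.{w}) (n m : ℕ) : Setoid (Diagram P.Gen n m) where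
  r f g := Diagram.Equiv P.Eqn f g
  iseqv := ⟨fun f => .refl f, fun h => .symm h, fun h h' => .trans h h'⟩

instance category (P : PropPresentation.{w}) : Category.{w} P.Carrier where
  Hom A B := Quotient (P.homSetoid A.width B.width)
  id A := Quotient.mk _ (Diagram.id A.width)
  comp f g := Quotient.map₂ Diagram.comp (fun _ _ h _ _ h' => Diagram.Equiv.comp_congr h h') f g
  id_comp f := by
    induction f using Quotient.inductionOn with | h f => exact Quotient.sound (.id_comp f)
  comp_id f := by
    induction f using Quotient.inductionOn with | h f => exact Quotient.sound (.comp_id f)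
  assoc f g h := by
    induction f using Quotient.inductionOn with | h f =>
    induction g using Quotient.inductionOn with | h g =>
    induction h using Quotient.inductionOn with | h h => exact Quotient.sound (.assoc f g h)

/-- The morphism of the presented prop that a diagram represents. -/
def hom (P : PropPresentation.{w}) {n m : ℕ} (f : Diagram P.Gen n m) :
    (⟨n⟩ : P.Carrier) ⟶ ⟨m⟩ :=
  Quotient.mk (P.homSetoid n m) f

theorem hom_eq (P : PropPresentation.{w}) {n m : ℕ} {f g : Diagram P.Gen n m}
    (h : Diagram.Equiv P.Eqn f g) : P.hom f = P.hom g :=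
  Quotient.sound h

theorem hom_surjective (P : PropPresentation.{w}) {A B : P.Carrier} (f : A ⟶ B) :
    ∃ d : Diagram P.Gen A.width B.width, f = P.hom d :=
  ⟨Quotient.out f, (Quotient.out_eq f).symm⟩

theorem hom_comp (P : PropPresentation.{w}) {n m k : ℕ} (f : Diagram P.Gen n m)
    (g : Diagram P.Gen m k) : P.hom (f.comp g) = P.hom f ≫ P.hom g :=
  rfl

theorem hom_id (P : PropPresentation.{w}) (n : ℕ) :
    P.hom (Diagram.id n) = 𝟙 (⟨n⟩ : P.Carrier) :=
  rfl

theorem hom_cast (P : PropPresentation.{w}) {n m n' m' : ℕ} (h : n = n') (h' : m = m')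
    (f : Diagram P.Gen n m) :
    P.hom (Diagram.cast h h' f) =
      eqToHom (by rw [h]) ≫ P.hom f ≫ eqToHom (by rw [h']) := by
  subst h; subst h'; simp [Diagram.cast]

instance monoidalStruct (P : PropPresentation.{w}) : MonoidalCategoryStruct P.Carrier where
  tensorObj A B := ⟨A.width + B.width⟩
  tensorUnit := ⟨0⟩
  tensorHom f g := Quotient.map₂ Diagram.tensor
    (fun _ _ h _ _ h' => Diagram.Equiv.tensor_congr h h') f g
  whiskerLeft A _ _ g := Quotient.map (fun d => (Diagram.id A.width).tensor d)
    (fun _ _ h => Diagram.Equiv.tensor_congr (.refl _) h) g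
  whiskerRight f B := Quotient.map (fun d => d.tensor (Diagram.id B.width))
    (fun _ _ h => Diagram.Equiv.tensor_congr h (.refl _)) f
  associator _ _ _ := eqToIso (Carrier.ext (Nat.add_assoc _ _ _))
  leftUnitor _ := eqToIso (Carrier.ext (Nat.zero_add _))
  rightUnitor _ := eqToIso (Carrier.ext (Nat.add_zero _))

theorem hom_tensor (P : PropPresentation.{w}) {n m n' m' : ℕ} (f : Diagram P.Gen n m)
    (g : Diagram P.Gen n' m') : P.hom (f.tensor g) = P.hom f ⊗ₘ P.hom g :=
  rfl

theorem associator_hom' (P : PropPresentation.{w}) (A B D : P.Carrier) :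
    (α_ A B D).hom = eqToHom (Carrier.ext (Nat.add_assoc _ _ _)) :=
  rfl

theorem leftUnitor_hom' (P : PropPresentation.{w}) (A : P.Carrier) :
    (λ_ A).hom = eqToHom (Carrier.ext (Nat.zero_add _)) :=
  rfl

theorem rightUnitor_hom' (P : PropPresentation.{w}) (A : P.Carrier) :
    (ρ_ A).hom = eqToHom (Carrier.ext (Nat.add_zero _)) :=
  rfl

theorem id_tensorHom_id' (P : PropPresentation.{w}) (A B : P.Carrier) :
    𝟙 A ⊗ₘ 𝟙 B = 𝟙 (A ⊗ B) :=
  P.hom_eq (.tensor_id A.width B.width)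

theorem eqToHom_tensorHom_id (P : PropPresentation.{w}) {A B : P.Carrier} (h : A = B)
    (D : P.Carrier) : eqToHom h ⊗ₘ 𝟙 D = eqToHom (by rw [h]) := by
  subst h; exact P.id_tensorHom_id' _ _

theorem id_tensorHom_eqToHom (P : PropPresentation.{w}) {A B : P.Carrier} (h : A = B)
    (D : P.Carrier) : 𝟙 D ⊗ₘ eqToHom h = eqToHom (by rw [h]) := by
  subst h; exact P.id_tensorHom_id' _ _

instance monoidal (P : PropPresentation.{w}) : MonoidalCategory P.Carrier :=
  MonoidalCategory.ofTensorHom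
    (id_tensorHom_id := fun A B => P.id_tensorHom_id' A B)
    (id_tensorHom := fun A _ _ f => by
      obtain ⟨f, rfl⟩ := P.hom_surjective f; rfl)
    (tensorHom_id := fun f B => by
      obtain ⟨f, rfl⟩ := P.hom_surjective f; rfl)
    (tensorHom_comp_tensorHom := fun f f' g g' => by
      obtain ⟨f, rfl⟩ := P.hom_surjective f
      obtain ⟨g, rfl⟩ := P.hom_surjective g
      obtain ⟨f', rfl⟩ := P.hom_surjective f'
      obtain ⟨g', rfl⟩ := P.hom_surjective g'
      exact (P.hom_eq (.interchange f g f' g')).symm)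
    (associator_naturality := fun f g h => by
      obtain ⟨f, rfl⟩ := P.hom_surjective f
      obtain ⟨g, rfl⟩ := P.hom_surjective g
      obtain ⟨h, rfl⟩ := P.hom_surjective h
      have := P.hom_eq (.tensor_assoc f g h)
      rw [hom_cast] at this
      simp only [hom_tensor] at this
      change (P.hom f ⊗ₘ P.hom g) ⊗ₘ P.hom h = _ at this
      rw [this]
      simp only [associator_hom', Category.assoc, eqToHom_trans]
      congr 1
      exact Category.comp_id _)
    (leftUnitor_naturality := fun f => by
      obtain ⟨f, rfl⟩ := P.hom_surjective f
      have := P.hom_eq (.unit_tensor f)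
      rw [hom_cast] at this
      simp only [hom_tensor, hom_id] at this
      change 𝟙 (⟨0⟩ : P.Carrier) ⊗ₘ P.hom f = _ at this
      change (𝟙 (⟨0⟩ : P.Carrier) ⊗ₘ P.hom f) ≫ _ = _
      rw [this]
      simp only [leftUnitor_hom', Category.assoc, eqToHom_trans]
      congr 1
      exact Category.comp_id _)
    (rightUnitor_naturality := fun f => by
      obtain ⟨f, rfl⟩ := P.hom_surjective f
      have := P.hom_eq (.tensor_unit f)
      rw [hom_cast] at this
      simp only [hom_tensor, hom_id] at this
      change P.hom f ⊗ₘ 𝟙 (⟨0⟩ : P.Carrier) = _ at this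
      change (P.hom f ⊗ₘ 𝟙 (⟨0⟩ : P.Carrier)) ≫ _ = _
      rw [this]
      simp only [rightUnitor_hom', Category.assoc, eqToHom_trans]
      congr 1
      exact Category.comp_id _)
    (pentagon := fun A B D E => by
      simp only [associator_hom', eqToHom_tensorHom_id, id_tensorHom_eqToHom]
      simp only [eqToHom_trans])
    (triangle := fun A B => by
      simp only [associator_hom', leftUnitor_hom', rightUnitor_hom', eqToHom_tensorHom_id,
        id_tensorHom_eqToHom]
      simp only [eqToHom_trans])

instance strict (P : PropPresentation.{w}) : StrictMonoidal P.Carrier where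
  tensor_assoc _ _ _ := Carrier.ext (Nat.add_assoc _ _ _)
  unit_tensor _ := Carrier.ext (Nat.zero_add _)
  tensor_unit _ := Carrier.ext (Nat.add_zero _)
  associator_hom _ _ _ := rfl
  leftUnitor_hom _ := rfl
  rightUnitor_hom _ := rfl

/-- The symmetry of the presented prop. -/
def swapIso (P : PropPresentation.{w}) (A B : P.Carrier) : A ⊗ B ≅ B ⊗ A where
  hom := P.hom (Diagram.swap A.width B.width)
  inv := P.hom (Diagram.swap B.width A.width)
  hom_inv_id := P.hom_eq (.swap_swap _ _)
  inv_hom_id := P.hom_eq (.swap_swap _ _)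

theorem swapIso_hexagon (P : PropPresentation.{w}) (X Y Z : P.Carrier) :
    (α_ X Y Z).hom ≫ (P.swapIso X (Y ⊗ Z)).hom ≫ (α_ Y Z X).hom =
      (P.swapIso X Y).hom ▷ Z ≫ (α_ Y X Z).hom ≫ Y ◁ (P.swapIso X Z).hom := by
  have h := P.hom_eq (.swap_add X.width Y.width Z.width)
  rw [hom_comp, hom_cast, hom_cast] at h
  have h' : (P.swapIso X (Y ⊗ Z)).hom =
      (eqToHom (Carrier.ext (Nat.add_assoc _ _ _).symm) ≫ (P.swapIso X Y).hom ▷ Z ≫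
        eqToHom (Carrier.ext (Nat.add_assoc _ _ _))) ≫
      (eqToHom rfl ≫ Y ◁ (P.swapIso X Z).hom ≫
        eqToHom (Carrier.ext (Nat.add_assoc _ _ _).symm)) := h
  simp only [h', associator_hom', Category.assoc, eqToHom_trans, eqToHom_trans_assoc,
    eqToHom_refl, Category.id_comp, Category.comp_id]

instance symmetric (P : PropPresentation.{w}) : SymmetricCategory P.Carrier where
  braiding := P.swapIso
  braiding_naturality_right A B B' f := by
    obtain ⟨f, rfl⟩ := P.hom_surjective f
    exact P.hom_eq (.swap_naturality (Diagram.id A.width) f)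
  braiding_naturality_left f B := by
    obtain ⟨f, rfl⟩ := P.hom_surjective f
    exact P.hom_eq (.swap_naturality f (Diagram.id B.width))
  hexagon_forward := P.swapIso_hexagon
  hexagon_reverse X Y Z := by
    have h := P.swapIso_hexagon Z X Y
    have h' : (α_ Z X Y ≪≫ P.swapIso Z (X ⊗ Y) ≪≫ α_ X Y Z) =
        (whiskerRightIso (P.swapIso Z X) Y ≪≫ α_ X Z Y ≪≫ whiskerLeftIso X (P.swapIso Z Y)) :=
      Iso.ext h
    have h'' := congrArg Iso.inv h'
    simp only [Iso.trans_inv, whiskerRightIso_inv, whiskerLeftIso_inv, Category.assoc] at h''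
    exact h''
  symmetry A B := P.hom_eq (.swap_swap _ _)

end PropPresentation

/-- A dagger symmetric monoidal category: an identity-on-objects, involutive, contravariant
symmetric monoidal functor. -/
class DaggerSymmetric (C : Type u) [Category.{v} C] [MonoidalCategory C] [SymmetricCategory C] where
  /-- the dagger of a morphism -/
  dagger : ∀ {A B : C}, (A ⟶ B) → (B ⟶ A)
  dagger_dagger : ∀ {A B : C} (f : A ⟶ B), dagger (dagger f) = f
  dagger_id : ∀ A : C, dagger (𝟙 A) = 𝟙 A
  dagger_comp : ∀ {A B D : C} (f : A ⟶ B) (g : B ⟶ D), dagger (f ≫ g) = dagger g ≫ dagger f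
  dagger_tensor : ∀ {A B A' B' : C} (f : A ⟶ B) (g : A' ⟶ B'),
    dagger (f ⊗ₘ g) = dagger f ⊗ₘ dagger g
  dagger_braiding : ∀ A B : C, dagger (β_ A B).hom = (β_ B A).hom

open DaggerSymmetric

/-- A dagger compact category: every object `A` has a (left) dual `A* = ᘁA`, with
`η : I ⟶ A* ⊗ A` and `ε : A ⊗ A* ⟶ I`, and the dagger of `ε` is `η` followed by the symmetry. -/
class DaggerCompact (C : Type u) [Category.{v} C] [MonoidalCategory C] [SymmetricCategory C]
    extends DaggerSymmetric C, LeftRigidCategory C where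
  dagger_evaluation : ∀ A : C,
    dagger (ε_ (ᘁA : C) A) = η_ (ᘁA : C) A ≫ (β_ (ᘁA : C) A).hom

section Dagger

variable {C : Type u} [Category.{v} C] [MonoidalCategory C] [SymmetricCategory C]

/-- Isometries: `u† ∘ u = 1`. -/
def IsIsometry [DaggerSymmetric C] {A B : C} (u : A ⟶ B) : Prop :=
  u ≫ dagger u = 𝟙 A

/-- A morphism `A ⟶ B ⊗ X` for some object `X`. -/
def Purification (A B : C) : Type (max u v) :=
  Σ X : C, (A ⟶ B ⊗ X)

/-- The endomorphism of `B ⊗ A` obtained from `f : A ⟶ B ⊗ X` by joining the `X` wires of `f` and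
of its dagger. -/
def cpEnd [DaggerSymmetric C] {A B X : C} (f : A ⟶ B ⊗ X) : B ⊗ A ⟶ B ⊗ A :=
  B ◁ f ≫ (α_ B B X).inv ≫ (β_ B B).hom ▷ X ≫ (α_ B B X).hom ≫ B ◁ dagger f

/-- The relation `∼_cp`. -/
def CPRel [DaggerSymmetric C] {A B : C} (f g : Purification A B) : Prop :=
  cpEnd f.2 = cpEnd g.2

/-- The relation `∼_iso`: `f` and `g` become equal after applying isometries to the ancillas. -/
def IsoRel [DaggerSymmetric C] {A B : C} (f g : Purification A B) : Prop :=
  ∃ (Z : C) (p : f.1 ⟶ Z) (q : g.1 ⟶ Z), IsIsometry p ∧ IsIsometry q ∧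
    f.2 ≫ B ◁ p = g.2 ≫ B ◁ q

end Dagger

/-- A dagger symmetric monoidal category has enough isometries if `∼_cp` is the transitive closure
of `∼_iso`. -/
def EnoughIsometries (C : Type u) [Category.{v} C] [MonoidalCategory C] [SymmetricCategory C]
    [DaggerSymmetric C] : Prop :=
  ∀ (A B : C) (f g : Purification A B), CPRel f g ↔ Relation.TransGen IsoRel f g

section DaggerLemmas

set_option linter.unusedSectionVars false

variable {C : Type u} [Category.{v} C] [MonoidalCategory C] [SymmetricCategory C]

theorem dagger_whiskerLeft [DaggerSymmetric C] {A B : C} (D : C) (f : A ⟶ B) :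
    dagger (D ◁ f) = D ◁ dagger f := by
  rw [← id_tensorHom, dagger_tensor, dagger_id, id_tensorHom]

theorem dagger_whiskerRight [DaggerSymmetric C] {A B : C} (f : A ⟶ B) (D : C) :
    dagger (f ▷ D) = dagger f ▷ D := by
  rw [← tensorHom_id, dagger_tensor, dagger_id, tensorHom_id]

theorem dagger_eqToHom [DaggerSymmetric C] {A B : C} (h : A = B) :
    dagger (eqToHom h) = eqToHom h.symm := by
  subst h; simp [dagger_id]

theorem dagger_associator [StrictMonoidal C] [DaggerSymmetric C] (A B D : C) :
    dagger (α_ A B D).hom = (α_ A B D).inv := by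
  rw [StrictMonoidal.associator_hom, StrictMonoidal.associator_inv, dagger_eqToHom]

theorem dagger_associator_inv [StrictMonoidal C] [DaggerSymmetric C] (A B D : C) :
    dagger (α_ A B D).inv = (α_ A B D).hom := by
  rw [StrictMonoidal.associator_hom, StrictMonoidal.associator_inv, dagger_eqToHom]

theorem dagger_leftUnitor [StrictMonoidal C] [DaggerSymmetric C] (A : C) :
    dagger (λ_ A).hom = (λ_ A).inv := by
  rw [StrictMonoidal.leftUnitor_hom, StrictMonoidal.leftUnitor_inv, dagger_eqToHom]

theorem dagger_rightUnitor [StrictMonoidal C] [DaggerSymmetric C] (A : C) :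
    dagger (ρ_ A).hom = (ρ_ A).inv := by
  rw [StrictMonoidal.rightUnitor_hom, StrictMonoidal.rightUnitor_inv, dagger_eqToHom]

theorem dagger_tensorμ [StrictMonoidal C] [DaggerSymmetric C] (A B A' B' : C) :
    dagger (tensorμ A B A' B') = tensorδ A B A' B' := by
  simp only [tensorμ, tensorδ, dagger_comp, dagger_associator, dagger_associator_inv,
    dagger_whiskerLeft, dagger_whiskerRight, dagger_braiding, Category.assoc,
    SymmetricCategory.braiding_swap_eq_inv_braiding B A']

theorem tensorμ_braiding (A B A' B' : C) :
    tensorμ A B A' B' ≫ ((β_ A A').hom ⊗ₘ (β_ B B').hom) =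
      (β_ (A ⊗ B) (A' ⊗ B')).hom ≫ tensorμ A' B' A B := by
  simp [tensorμ, MonoidalCategory.tensorHom_def, SymmetricCategory.braiding_swap_eq_inv_braiding A B']

theorem tensorδ_eq_tensorμ (A B A' B' : C) :
    tensorδ A A' B B' = tensorμ A B A' B' := by
  simp [tensorμ, tensorδ, SymmetricCategory.braiding_swap_eq_inv_braiding A' B]

theorem cpEnd_comp_isometry [DaggerSymmetric C] {A B X Z : C} (f : A ⟶ B ⊗ X) (p : X ⟶ Z)
    (hp : IsIsometry p) : cpEnd (f ≫ B ◁ p) = cpEnd f := by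
  have e : B ◁ B ◁ p ≫ (α_ B B Z).inv ≫ (β_ B B).hom ▷ Z ≫ (α_ B B Z).hom ≫ B ◁ B ◁ dagger p =
      (α_ B B X).inv ≫ (β_ B B).hom ▷ X ≫ (α_ B B X).hom := by
    have : B ◁ B ◁ p ≫ (α_ B B Z).inv ≫ (β_ B B).hom ▷ Z ≫ (α_ B B Z).hom =
        (α_ B B X).inv ≫ (β_ B B).hom ▷ X ≫ (α_ B B X).hom ≫ B ◁ B ◁ p := by
      rw [associator_inv_naturality_right_assoc, whisker_exchange_assoc, associator_naturality_right]
    rw [reassoc_of% this, ← whiskerLeft_comp, ← whiskerLeft_comp]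
    rw [show p ≫ dagger p = 𝟙 X from hp]; simp
  unfold cpEnd
  rw [dagger_comp, dagger_whiskerLeft, whiskerLeft_comp, whiskerLeft_comp, Category.assoc,
    reassoc_of% e]

/-- Tensor product of purifications. -/
def purTensor {A B X A' B' X' : C} (f : A ⟶ B ⊗ X) (g : A' ⟶ B' ⊗ X') :
    A ⊗ A' ⟶ (B ⊗ B') ⊗ (X ⊗ X') :=
  (f ⊗ₘ g) ≫ tensorμ B X B' X'

/-- Composition of purifications. -/
def purComp {A B D X Y : C} (f : A ⟶ B ⊗ X) (g : B ⟶ D ⊗ Y) : A ⟶ D ⊗ (Y ⊗ X) :=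
  f ≫ g ▷ X ≫ (α_ D Y X).hom

theorem cpEnd_purTensor [StrictMonoidal C] [DaggerSymmetric C] {A B X A' B' X' : C}
    (f : A ⟶ B ⊗ X) (g : A' ⟶ B' ⊗ X') :
    cpEnd (purTensor f g) =
      tensorμ B B' A A' ≫ (cpEnd f ⊗ₘ cpEnd g) ≫ tensorδ B B' A A' := by
  have key : (B ⊗ B') ◁ tensorμ B X B' X' ≫ (α_ (B ⊗ B') (B ⊗ B') (X ⊗ X')).inv ≫
      (β_ (B ⊗ B') (B ⊗ B')).hom ▷ (X ⊗ X') ≫ (α_ (B ⊗ B') (B ⊗ B') (X ⊗ X')).hom =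
      tensorμ B B' (B ⊗ X) (B' ⊗ X') ≫
      (((α_ B B X).inv ≫ (β_ B B).hom ▷ X ≫ (α_ B B X).hom) ⊗ₘ
        ((α_ B' B' X').inv ≫ (β_ B' B').hom ▷ X' ≫ (α_ B' B' X').hom)) ≫
      tensorδ B B' (B ⊗ X) (B' ⊗ X') ≫ (B ⊗ B') ◁ tensorμ B X B' X' := by
    have h := tensor_associativity B B' B B' X X'
    have hb := tensorμ_braiding B B' B B'
    have hn := tensorμ_natural_left (β_ B B).hom (β_ B' B').hom X X'
    have h4 : tensorμ B B' (B ⊗ X) (B' ⊗ X') =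
        (B ⊗ B') ◁ tensorδ B B' X X' ≫ (α_ (B ⊗ B') (B ⊗ B') (X ⊗ X')).inv ≫
        tensorμ B B' B B' ▷ (X ⊗ X') ≫ tensorμ (B ⊗ B) (B' ⊗ B') X X' ≫
        ((α_ B B X).hom ⊗ₘ (α_ B' B' X').hom) := by
      rw [h, Iso.inv_hom_id_assoc, ← whiskerLeft_comp_assoc, tensorδ_tensorμ]; simp
    have h5 : tensorμ B B' (B ⊗ X) (B' ⊗ X') ≫
        (((α_ B B X).inv ≫ (β_ B B).hom ▷ X ≫ (α_ B B X).hom) ⊗ₘ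
        ((α_ B' B' X').inv ≫ (β_ B' B').hom ▷ X' ≫ (α_ B' B' X').hom)) =
        (B ⊗ B') ◁ tensorδ B B' X X' ≫ (α_ (B ⊗ B') (B ⊗ B') (X ⊗ X')).inv ≫
        (β_ (B ⊗ B') (B ⊗ B')).hom ▷ (X ⊗ X') ≫ (α_ (B ⊗ B') (B ⊗ B') (X ⊗ X')).hom ≫
        (B ⊗ B') ◁ tensorμ B B' X X' ≫ tensorμ B B' (B ⊗ X) (B' ⊗ X') := by
      rw [← h, ← comp_whiskerRight_assoc, ← hb, comp_whiskerRight_assoc, reassoc_of% hn, h4]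
      simp only [Category.assoc, tensorHom_comp_tensorHom, Iso.hom_inv_id_assoc]
    rw [reassoc_of% h5, tensorμ_tensorδ_assoc, ← tensorδ_eq_tensorμ, ← whiskerLeft_comp,
      tensorμ_tensorδ]
    simp
  have h1 := tensorμ_natural_right B B' f g
  have h2 : dagger (purTensor f g) = tensorδ B X B' X' ≫ (dagger f ⊗ₘ dagger g) := by
    rw [purTensor, dagger_comp, dagger_tensorμ, dagger_tensor]
  have h3 : tensorδ B B' (B ⊗ X) (B' ⊗ X') ≫ (B ⊗ B') ◁ (dagger f ⊗ₘ dagger g) =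
      (B ◁ dagger f ⊗ₘ B' ◁ dagger g) ≫ tensorδ B B' A A' := by
    have := tensorμ_natural_right B B' (dagger f) (dagger g)
    calc _ = tensorδ B B' (B ⊗ X) (B' ⊗ X') ≫ (B ⊗ B') ◁ (dagger f ⊗ₘ dagger g) ≫
          tensorμ B B' A A' ≫ tensorδ B B' A A' := by simp
      _ = _ := by rw [reassoc_of% this, tensorδ_tensorμ_assoc]
  rw [cpEnd, h2, purTensor]
  simp only [whiskerLeft_comp, Category.assoc]
  rw [reassoc_of% key, ← whiskerLeft_comp_assoc (B ⊗ B') (tensorμ B X B' X'), tensorμ_tensorδ]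
  simp only [whiskerLeft_id, Category.id_comp]
  rw [h3, reassoc_of% h1, cpEnd, cpEnd]
  simp only [tensorHom_comp_tensorHom_assoc, Category.assoc]

/-- The morphism `f_* : A* ⟶ X* ⊗ B*`, the dual of the dagger of `f : A ⟶ B ⊗ X`, up to the
canonical isomorphism `(B ⊗ X)* ≅ X* ⊗ B*`. -/
def lowerStar [DaggerCompact C] {A B X : C} (f : A ⟶ B ⊗ X) :
    (ᘁA : C) ⟶ (ᘁX : C) ⊗ (ᘁB : C) :=
  leftAdjointMate (dagger f) ≫ (leftDualTensorIso B X).hom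

/-- The contraction `X ⊗ (X* ⊗ D) ⟶ D`. -/
def contract [LeftRigidCategory C] (X D : C) : X ⊗ ((ᘁX : C) ⊗ D) ⟶ D :=
  (α_ X (ᘁX : C) D).inv ≫ ε_ (ᘁX : C) X ▷ D ≫ (λ_ D).hom

/-- The completely positive morphism `A ⊗ A* ⟶ B ⊗ B*` with purification `f : A ⟶ B ⊗ X`: the
morphism `f ⊗ f_*` with the wires `X` and `X*` joined. -/
def cpMap [DaggerCompact C] {A B X : C} (f : A ⟶ B ⊗ X) :
    A ⊗ (ᘁA : C) ⟶ B ⊗ (ᘁB : C) :=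
  (f ⊗ₘ lowerStar f) ≫ (α_ B X ((ᘁX : C) ⊗ (ᘁB : C))).hom ≫ B ◁ contract X (ᘁB : C)

/-- Auxiliary: `f_*` with its ancilla bent down. -/
def flat [DaggerCompact C] {A B X : C} (f : A ⟶ B ⊗ X) : X ⊗ (ᘁA : C) ⟶ (ᘁB : C) :=
  X ◁ lowerStar f ≫ contract X (ᘁB : C)

theorem cpMap_eq [DaggerCompact C] {A B X : C} (f : A ⟶ B ⊗ X) :
    cpMap f = f ▷ (ᘁA : C) ≫ (α_ B X (ᘁA : C)).hom ≫ B ◁ flat f := by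
  simp [cpMap, flat, MonoidalCategory.tensorHom_def]

theorem leftDualTensorIso_evaluation [LeftRigidCategory C] (B X : C) :
    (α_ B X (ᘁ(B ⊗ X) : C)).inv ≫ ε_ (ᘁ(B ⊗ X) : C) (B ⊗ X) =
      B ◁ (X ◁ (leftDualTensorIso B X).hom ≫ contract X (ᘁB : C)) ≫ ε_ (ᘁB : C) B := by
  have h := @leftAdjointMate_comp_evaluation C _ _ (B ⊗ X) (B ⊗ X) ⟨(ᘁX : C) ⊗ (ᘁB : C)⟩
    (LeftRigidCategory.leftDual (B ⊗ X)) (𝟙 (B ⊗ X))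
  have h' : (B ⊗ X) ◁ (leftDualTensorIso B X).hom ≫
      @ExactPairing.evaluation C _ _ ((ᘁX : C) ⊗ (ᘁB : C)) (B ⊗ X) ExactPairing.tensor =
      ε_ (ᘁ(B ⊗ X) : C) (B ⊗ X) := by
    refine Eq.trans h ?_
    simp
  rw [← h', ExactPairing.tensor_evaluation]
  simp only [contract]
  monoidal

theorem flat_evaluation [DaggerCompact C] {A B X : C} (f : A ⟶ B ⊗ X) :
    B ◁ flat f ≫ ε_ (ᘁB : C) B =
      (α_ B X (ᘁA : C)).inv ≫ dagger f ▷ (ᘁA : C) ≫ ε_ (ᘁA : C) A := by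
  rw [← leftAdjointMate_comp_evaluation (dagger f), flat, lowerStar]
  have := leftDualTensorIso_evaluation B X
  simp only [whiskerLeft_comp, Category.assoc] at this ⊢
  rw [← this]
  simp

theorem dual_hom_ext [LeftRigidCategory C] {B W : C} {g g' : W ⟶ (ᘁB : C)}
    (h : B ◁ g ≫ ε_ (ᘁB : C) B = B ◁ g' ≫ ε_ (ᘁB : C) B) : g = g' := by
  have h1 := tensorLeftHomEquiv_whiskerLeft_comp_evaluation g
  rw [h, tensorLeftHomEquiv_whiskerLeft_comp_evaluation g'] at h1
  exact ((cancel_mono _).1 h1).symm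

theorem flat_purComp [StrictMonoidal C] [DaggerCompact C] {A B D X Y : C} (f : A ⟶ B ⊗ X)
    (g : B ⟶ D ⊗ Y) :
    flat (purComp f g) = (α_ Y X (ᘁA : C)).hom ≫ Y ◁ flat f ≫ flat g := by
  apply dual_hom_ext
  rw [flat_evaluation, purComp]
  simp only [whiskerLeft_comp, Category.assoc, flat_evaluation]
  have h := whisker_exchange (dagger g) (flat f)
  rw [tensor_whiskerLeft] at h
  have h' : D ◁ Y ◁ flat f ≫ (α_ D Y (ᘁB : C)).inv ≫ dagger g ▷ (ᘁB : C) =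
      (α_ D Y (X ⊗ (ᘁA : C))).inv ≫ dagger g ▷ (X ⊗ (ᘁA : C)) ≫ B ◁ flat f := by
    rw [← h]; simp
  rw [reassoc_of% h', flat_evaluation]
  simp [dagger_comp, dagger_associator, dagger_whiskerRight]

theorem cpMap_comp [StrictMonoidal C] [DaggerCompact C] {A B D X Y : C} (f : A ⟶ B ⊗ X)
    (g : B ⟶ D ⊗ Y) : cpMap f ≫ cpMap g = cpMap (purComp f g) := by
  simp only [cpMap_eq, flat_purComp, Category.assoc]
  rw [whisker_exchange_assoc]
  simp [purComp]

theorem cpMap_evaluation [DaggerCompact C] {A B X : C} (f : A ⟶ B ⊗ X) :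
    B ◁ cpMap f ≫ (α_ B B (ᘁB : C)).inv ≫ (β_ B B).hom ▷ (ᘁB : C) ≫ (α_ B B (ᘁB : C)).hom ≫
      B ◁ ε_ (ᘁB : C) B =
    (α_ B A (ᘁA : C)).inv ≫ cpEnd f ▷ (ᘁA : C) ≫ (α_ B A (ᘁA : C)).hom ≫ B ◁ ε_ (ᘁA : C) A := by
  have h : B ◁ B ◁ flat f ≫ (α_ B B (ᘁB : C)).inv ≫ (β_ B B).hom ▷ (ᘁB : C) ≫
      (α_ B B (ᘁB : C)).hom = (α_ B B _).inv ≫ (β_ B B).hom ▷ _ ≫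
      (α_ B B _).hom ≫ B ◁ B ◁ flat f := by
    rw [associator_inv_naturality_right_assoc, whisker_exchange_assoc, associator_naturality_right]
  rw [cpMap_eq]
  simp only [whiskerLeft_comp, Category.assoc]
  rw [reassoc_of% h, ← whiskerLeft_comp, flat_evaluation]
  simp [cpEnd]

theorem cpMap_eq_iff_cpEnd_eq [DaggerCompact C] {A B X Y : C} (f : A ⟶ B ⊗ X) (g : A ⟶ B ⊗ Y) :
    cpMap f = cpMap g ↔ cpEnd f = cpEnd g := by
  constructor
  · intro h
    have h1 := cpMap_evaluation f
    rw [h, cpMap_evaluation g] at h1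
    apply (tensorRightHomEquiv (B ⊗ A) (ᘁA : C) A B).symm.injective
    have h2 := (cancel_epi _).1 h1
    simp only [tensorRightHomEquiv, Equiv.coe_fn_symm_mk]
    rw [reassoc_of% h2]
  · intro h
    have h1 := cpMap_evaluation f
    rw [h, ← cpMap_evaluation g] at h1
    have hs : (α_ B B (ᘁB : C)).inv ≫ (β_ B B).hom ▷ (ᘁB : C) ≫ (α_ B B (ᘁB : C)).hom ≫
      B ◁ ε_ (ᘁB : C) B ≫ (ρ_ B).hom =
      B ◁ (β_ B (ᘁB : C)).hom ≫ (α_ B (ᘁB : C) B).inv ≫ ε_ (ᘁB : C) B ▷ B ≫ (λ_ B).hom := by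
      have hn := BraidedCategory.braiding_naturality_right B (ε_ (ᘁB : C) B)
      rw [BraidedCategory.braiding_tensor_right_hom] at hn
      have hn' : (α_ B B (ᘁB : C)).inv ≫ (β_ B B).hom ▷ (ᘁB : C) ≫ (α_ B B (ᘁB : C)).hom ≫
          B ◁ (β_ B (ᘁB : C)).hom ≫ (α_ B (ᘁB : C) B).inv ≫ ε_ (ᘁB : C) B ▷ B ≫ (λ_ B).hom =
          B ◁ ε_ (ᘁB : C) B ≫ (ρ_ B).hom := by
        rw [← braiding_leftUnitor, reassoc_of% hn]
      rw [← hn']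
      simp [← comp_whiskerRight_assoc]
    have h2 : (cpMap f ≫ (β_ B (ᘁB : C)).hom) = (cpMap g ≫ (β_ B (ᘁB : C)).hom) := by
      apply (tensorLeftHomEquiv (A ⊗ (ᘁA : C)) (ᘁB : C) B B).symm.injective
      simp only [tensorLeftHomEquiv, Equiv.coe_fn_symm_mk, whiskerLeft_comp, Category.assoc]
      rw [← hs, reassoc_of% h1]
    exact (cancel_mono _).1 h2

theorem cpMap_comp_isometry [DaggerCompact C] {A B X Z : C} (f : A ⟶ B ⊗ X) (p : X ⟶ Z)
    (hp : IsIsometry p) : cpMap (f ≫ B ◁ p) = cpMap f :=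
  (cpMap_eq_iff_cpEnd_eq _ _).2 (cpEnd_comp_isometry f p hp)

theorem cpMap_purTensor_congr [StrictMonoidal C] [DaggerCompact C] {A B X Y A' B' X' Y' : C}
    {f : A ⟶ B ⊗ X} {g : A ⟶ B ⊗ Y} {f' : A' ⟶ B' ⊗ X'} {g' : A' ⟶ B' ⊗ Y'}
    (h : cpMap f = cpMap g) (h' : cpMap f' = cpMap g') :
    cpMap (purTensor f f') = cpMap (purTensor g g') := by
  rw [cpMap_eq_iff_cpEnd_eq] at h h' ⊢
  rw [cpEnd_purTensor, cpEnd_purTensor, h, h']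

theorem isIsometry_eqToHom [DaggerSymmetric C] {A B : C} (h : A = B) :
    IsIsometry (eqToHom h) := by
  simp [IsIsometry, dagger_eqToHom]

theorem isIsometry_associator [StrictMonoidal C] [DaggerSymmetric C] (A B D : C) :
    IsIsometry (α_ A B D).hom := by
  simp [IsIsometry, dagger_associator]

theorem isIsometry_leftUnitor [StrictMonoidal C] [DaggerSymmetric C] (A : C) :
    IsIsometry (λ_ A).hom := by
  simp [IsIsometry, dagger_leftUnitor]

theorem isIsometry_rightUnitor [StrictMonoidal C] [DaggerSymmetric C] (A : C) :
    IsIsometry (ρ_ A).hom := by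
  simp [IsIsometry, dagger_rightUnitor]

theorem isIsometry_braiding [DaggerSymmetric C] (A B : C) :
    IsIsometry (β_ A B).hom := by
  simp [IsIsometry, dagger_braiding]

theorem isIsometry_tensorμ [StrictMonoidal C] [DaggerSymmetric C] (A B A' B' : C) :
    IsIsometry (tensorμ A B A' B') := by
  simp [IsIsometry, dagger_tensorμ]

/-- The trivial purification of a pure morphism. -/
def purePur {A B : C} (f : A ⟶ B) : A ⟶ B ⊗ 𝟙_ C :=
  f ≫ (ρ_ B).inv

theorem cpMap_purComp_purePur [StrictMonoidal C] [DaggerCompact C] {A B D X : C} (f : A ⟶ B ⊗ X)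
    (g : B ⟶ D) : cpMap (purComp f (purePur g)) = cpMap (f ≫ g ▷ X) := by
  rw [← cpMap_comp_isometry _ _ (isIsometry_leftUnitor X)]
  congr 1
  simp [purComp, purePur]

theorem cpMap_purePur_purComp [StrictMonoidal C] [DaggerCompact C] {A B D X : C} (f : A ⟶ B)
    (g : B ⟶ D ⊗ X) : cpMap (purComp (purePur f) g) = cpMap (f ≫ g) := by
  rw [← cpMap_comp_isometry _ _ (isIsometry_rightUnitor X)]
  congr 1
  simp [purComp, purePur]

theorem cpMap_purTensor_purePur [StrictMonoidal C] [DaggerCompact C] {A B A' B' : C} (f : A ⟶ B)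
    (g : A' ⟶ B') : cpMap (purTensor (purePur f) (purePur g)) = cpMap (purePur (f ⊗ₘ g)) := by
  rw [← cpMap_comp_isometry _ _ (isIsometry_leftUnitor (𝟙_ C))]
  congr 1
  have h := rightUnitor_monoidal B B'
  have h' : tensorμ B (𝟙_ C) B' (𝟙_ C) ≫ (B ⊗ B') ◁ (λ_ (𝟙_ C)).hom =
      ((ρ_ B).hom ⊗ₘ (ρ_ B').hom) ≫ (ρ_ (B ⊗ B')).inv := by
    rw [h]; simp
  simp only [purTensor, purePur, Category.assoc]
  rw [h', tensorHom_comp_tensorHom_assoc]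
  simp

theorem cpMap_id [StrictMonoidal C] [DaggerCompact C] (A : C) :
    cpMap (purePur (𝟙 A)) = 𝟙 (A ⊗ (ᘁA : C)) := by
  rw [cpMap_eq]
  have h : flat (purePur (𝟙 A)) = (λ_ (ᘁA : C)).hom := by
    apply dual_hom_ext
    rw [flat_evaluation, purePur, Category.id_comp, ← dagger_rightUnitor, dagger_dagger]
    simp
  rw [h]
  simp [purePur]

theorem purTensor_comp [StrictMonoidal C] [DaggerCompact C] {A B D X Y A' B' D' X' Y' : C}
    (f : A ⟶ B ⊗ X) (g : B ⟶ D ⊗ Y) (f' : A' ⟶ B' ⊗ X') (g' : B' ⟶ D' ⊗ Y') :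
    cpMap (purComp (purTensor f f') (purTensor g g')) =
      cpMap (purTensor (purComp f g) (purComp f' g')) := by
  rw [← cpMap_comp_isometry (purTensor (purComp f g) (purComp f' g')) _
    (isIsometry_tensorμ Y X Y' X')]
  congr 1
  have h := associator_monoidal D Y X D' Y' X'
  have hn := tensorμ_natural g (𝟙 X) g' (𝟙 X')
  simp only [tensorHom_id, id_whiskerRight] at hn
  simp only [purComp, purTensor, comp_whiskerRight, Category.assoc]
  have h1 : ((f ≫ g ▷ X ≫ (α_ D Y X).hom) ⊗ₘ (f' ≫ g' ▷ X' ≫ (α_ D' Y' X').hom)) =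
      (f ⊗ₘ f') ≫ (g ▷ X ⊗ₘ g' ▷ X') ≫ ((α_ D Y X).hom ⊗ₘ (α_ D' Y' X').hom) := by
    simp
  rw [h1]
  simp only [Category.assoc]
  rw [← h, reassoc_of% hn]

theorem purTensor_assoc [StrictMonoidal C] [DaggerCompact C] {A B X A' B' X' A'' B'' X'' : C}
    (f : A ⟶ B ⊗ X) (g : A' ⟶ B' ⊗ X') (h : A'' ⟶ B'' ⊗ X'') :
    cpMap (purTensor (purTensor f g) h ≫ (α_ B B' B'').hom ▷ _) =
      cpMap ((α_ A A' A'').hom ≫ purTensor f (purTensor g h)) := by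
  rw [← cpMap_comp_isometry (purTensor (purTensor f g) h ≫ (α_ B B' B'').hom ▷ _) _
    (isIsometry_associator X X' X'')]
  congr 1
  have ht := tensor_associativity B X B' X' B'' X''
  simp only [purTensor]
  have h1 : ((f ⊗ₘ g) ≫ tensorμ B X B' X') ⊗ₘ h =
      ((f ⊗ₘ g) ⊗ₘ h) ≫ tensorμ B X B' X' ▷ (B'' ⊗ X'') := by
    rw [← tensorHom_id, tensorHom_comp_tensorHom, Category.comp_id]
  have h2 : f ⊗ₘ ((g ⊗ₘ h) ≫ tensorμ B' X' B'' X'') =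
      (f ⊗ₘ (g ⊗ₘ h)) ≫ (B ⊗ X) ◁ tensorμ B' X' B'' X'' := by
    rw [← id_tensorHom, tensorHom_comp_tensorHom, Category.comp_id]
  rw [h1, h2]
  simp only [Category.assoc]
  rw [← MonoidalCategory.tensorHom_def, ht, associator_naturality_assoc]

theorem purTensor_unit_left [StrictMonoidal C] [DaggerCompact C] {A B X : C} (f : A ⟶ B ⊗ X) :
    cpMap (purTensor (purePur (𝟙 (𝟙_ C))) f ≫ (λ_ B).hom ▷ _) = cpMap ((λ_ A).hom ≫ f) := by
  rw [← cpMap_comp_isometry (purTensor (purePur (𝟙 (𝟙_ C))) f ≫ (λ_ B).hom ▷ _) _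
    (isIsometry_leftUnitor X)]
  congr 1
  have h := tensor_left_unitality B X
  simp only [purTensor, purePur, Category.assoc, Category.id_comp]
  rw [← MonoidalCategory.tensorHom_def]
  have h1 : (ρ_ (𝟙_ C)).inv ⊗ₘ f = 𝟙_ C ◁ f ≫ (λ_ (𝟙_ C)).inv ▷ (B ⊗ X) := by
    rw [MonoidalCategory.tensorHom_def', unitors_inv_equal]
  rw [h1, Category.assoc, ← h]
  simp

theorem purTensor_unit_right [StrictMonoidal C] [DaggerCompact C] {A B X : C} (f : A ⟶ B ⊗ X) :
    cpMap (purTensor f (purePur (𝟙 (𝟙_ C))) ≫ (ρ_ B).hom ▷ _) = cpMap ((ρ_ A).hom ≫ f) := by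
  rw [← cpMap_comp_isometry (purTensor f (purePur (𝟙 (𝟙_ C))) ≫ (ρ_ B).hom ▷ _) _
    (isIsometry_rightUnitor X)]
  congr 1
  have h := tensor_right_unitality B X
  simp only [purTensor, purePur, Category.assoc, Category.id_comp]
  rw [← MonoidalCategory.tensorHom_def]
  have h1 : f ⊗ₘ (ρ_ (𝟙_ C)).inv = f ▷ 𝟙_ C ≫ (B ⊗ X) ◁ (λ_ (𝟙_ C)).inv := by
    rw [MonoidalCategory.tensorHom_def, unitors_inv_equal]
  rw [h1, Category.assoc, ← h]
  simp

theorem purTensor_braiding [StrictMonoidal C] [DaggerCompact C] {A B X A' B' X' : C}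
    (f : A ⟶ B ⊗ X) (g : A' ⟶ B' ⊗ X') :
    cpMap (purTensor f g ≫ (β_ B B').hom ▷ _) = cpMap ((β_ A A').hom ≫ purTensor g f) := by
  rw [← cpMap_comp_isometry (purTensor f g ≫ (β_ B B').hom ▷ _) _ (isIsometry_braiding X X')]
  congr 1
  simp only [purTensor, Category.assoc]
  rw [← MonoidalCategory.tensorHom_def, tensorμ_braiding, BraidedCategory.braiding_naturality_assoc]

end DaggerLemmas

/-- The objects of `CPM(C)`: those of `C`. -/
structure CPM (C : Type u) where of ::
  /-- the underlying object of `C` -/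
  obj : C

namespace CPM

variable {C : Type u} [Category.{v} C] [MonoidalCategory C] [SymmetricCategory C]
  [StrictMonoidal C] [DaggerCompact C]

/-- `CPM(C)` has as morphisms `A ⟶ B` the morphisms `A ⊗ A* ⟶ B ⊗ B*` of `C` that are of the form
`cpMap f` for some `f : A ⟶ B ⊗ X` in `C`; they compose as in `C`. -/
instance category : Category.{v} (CPM C) where
  Hom A B := {φ : A.obj ⊗ (ᘁA.obj : C) ⟶ B.obj ⊗ (ᘁB.obj : C) //
    ∃ (X : C) (f : A.obj ⟶ B.obj ⊗ X), φ = cpMap f}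
  id A := ⟨𝟙 _, 𝟙_ C, purePur (𝟙 A.obj), (cpMap_id A.obj).symm⟩
  comp φ ψ := ⟨φ.1 ≫ ψ.1, by
    obtain ⟨_, X, f, rfl⟩ := φ
    obtain ⟨_, Y, g, rfl⟩ := ψ
    exact ⟨Y ⊗ X, purComp f g, cpMap_comp f g⟩⟩
  id_comp _ := Subtype.ext (Category.id_comp _)
  comp_id _ := Subtype.ext (Category.comp_id _)
  assoc _ _ _ := Subtype.ext (Category.assoc _ _ _)

/-- The morphism of `CPM(C)` with purification `f`. -/
def mk {A B X : C} (f : A ⟶ B ⊗ X) : (⟨A⟩ : CPM C) ⟶ ⟨B⟩ :=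
  ⟨cpMap f, X, f, rfl⟩

theorem mk_eq {A B X Y : C} {f : A ⟶ B ⊗ X} {g : A ⟶ B ⊗ Y} (h : cpMap f = cpMap g) :
    mk f = mk g :=
  Subtype.ext h

theorem exists_mk {A B : CPM C} (φ : A ⟶ B) : ∃ (X : C) (f : A.obj ⟶ B.obj ⊗ X), φ = mk f := by
  obtain ⟨_, X, f, rfl⟩ := φ
  exact ⟨X, f, rfl⟩

theorem mk_comp {A B D X Y : C} (f : A ⟶ B ⊗ X) (g : B ⟶ D ⊗ Y) :
    mk f ≫ mk g = mk (purComp f g) :=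
  Subtype.ext (cpMap_comp f g)

/-- The inclusion of pure morphisms: `f ↦ f ⊗ f_*`. -/
def pure {A B : C} (f : A ⟶ B) : (⟨A⟩ : CPM C) ⟶ ⟨B⟩ :=
  mk (purePur f)

theorem pure_id (A : C) : pure (𝟙 A) = 𝟙 (⟨A⟩ : CPM C) :=
  Subtype.ext (cpMap_id A)

theorem mk_comp_pure {A B D X : C} (f : A ⟶ B ⊗ X) (g : B ⟶ D) :
    mk f ≫ pure g = mk (f ≫ g ▷ X) := by
  rw [pure, mk_comp]; exact mk_eq (cpMap_purComp_purePur f g)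

theorem pure_comp_mk {A B D X : C} (f : A ⟶ B) (g : B ⟶ D ⊗ X) :
    pure f ≫ mk g = mk (f ≫ g) := by
  rw [pure, mk_comp]; exact mk_eq (cpMap_purePur_purComp f g)

theorem pure_comp {A B D : C} (f : A ⟶ B) (g : B ⟶ D) :
    pure (f ≫ g) = pure f ≫ pure g := by
  conv_rhs => rw [pure, mk_comp_pure]
  simp [pure, purePur]

theorem pure_eqToHom {A B : C} (h : A = B) :
    pure (eqToHom h) = eqToHom (congrArg CPM.of h) := by
  subst h; exact pure_id _

/-- Isomorphisms of `C` as isomorphisms of `CPM(C)`. -/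
def pureIso {A B : C} (e : A ≅ B) : (⟨A⟩ : CPM C) ≅ ⟨B⟩ where
  hom := pure e.hom
  inv := pure e.inv
  hom_inv_id := by rw [← pure_comp, e.hom_inv_id, pure_id]
  inv_hom_id := by rw [← pure_comp, e.inv_hom_id, pure_id]

/-- The tensor product of completely positive morphisms is computed on purifications; by
`CPM.mk_tensor` it does not depend on the purifications chosen. -/
noncomputable def tensor {A B A' B' : CPM C} (φ : A ⟶ B) (ψ : A' ⟶ B') :
    (⟨A.obj ⊗ A'.obj⟩ : CPM C) ⟶ ⟨B.obj ⊗ B'.obj⟩ :=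
  mk (purTensor (exists_mk φ).choose_spec.choose (exists_mk ψ).choose_spec.choose)

theorem mk_tensor {A B A' B' X X' : C} (f : A ⟶ B ⊗ X) (g : A' ⟶ B' ⊗ X') :
    tensor (mk f) (mk g) = mk (purTensor f g) := by
  have hf := (exists_mk (mk f)).choose_spec.choose_spec
  have hg := (exists_mk (mk g)).choose_spec.choose_spec
  exact mk_eq (cpMap_purTensor_congr (congrArg Subtype.val hf).symm (congrArg Subtype.val hg).symm)

noncomputable instance monoidalStruct : MonoidalCategoryStruct (CPM C) where
  tensorObj A B := ⟨A.obj ⊗ B.obj⟩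
  tensorUnit := ⟨𝟙_ C⟩
  tensorHom φ ψ := tensor φ ψ
  whiskerLeft A _ _ ψ := tensor (𝟙 A) ψ
  whiskerRight φ B := tensor φ (𝟙 B)
  associator A B D := pureIso (α_ A.obj B.obj D.obj)
  leftUnitor A := pureIso (λ_ A.obj)
  rightUnitor A := pureIso (ρ_ A.obj)

theorem mk_tensorHom_mk {A B A' B' X X' : C} (f : A ⟶ B ⊗ X) (g : A' ⟶ B' ⊗ X') :
    mk f ⊗ₘ mk g = mk (purTensor f g) :=
  mk_tensor f g

theorem pure_tensorHom_pure {A B A' B' : C} (f : A ⟶ B) (g : A' ⟶ B') :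
    pure f ⊗ₘ pure g = pure (f ⊗ₘ g) :=
  (mk_tensor _ _).trans (mk_eq (cpMap_purTensor_purePur f g))

theorem associator_hom' (A B D : CPM C) : (α_ A B D).hom = pure (α_ A.obj B.obj D.obj).hom :=
  rfl

theorem leftUnitor_hom' (A : CPM C) : (λ_ A).hom = pure (λ_ A.obj).hom :=
  rfl

theorem rightUnitor_hom' (A : CPM C) : (ρ_ A).hom = pure (ρ_ A.obj).hom :=
  rfl

theorem id_eq_pure (A : CPM C) : 𝟙 A = pure (𝟙 A.obj) :=
  (pure_id A.obj).symm

noncomputable instance monoidal : MonoidalCategory (CPM C) :=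
  MonoidalCategory.ofTensorHom
    (id_tensorHom_id := fun A B => by
      rw [id_eq_pure, id_eq_pure]
      refine (pure_tensorHom_pure _ _).trans ?_
      rw [id_tensorHom_id]
      exact pure_id _)
    (id_tensorHom := fun _ _ _ _ => rfl)
    (tensorHom_id := fun _ _ => rfl)
    (tensorHom_comp_tensorHom := fun φ φ' ψ ψ' => by
      obtain ⟨X, f, rfl⟩ := exists_mk φ
      obtain ⟨X', f', rfl⟩ := exists_mk φ'
      obtain ⟨Y, g, rfl⟩ := exists_mk ψ
      obtain ⟨Y', g', rfl⟩ := exists_mk ψ'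
      refine (congrArg₂ _ (mk_tensor f f') (mk_tensor g g')).trans ((mk_comp _ _).trans ?_)
      refine (mk_eq (purTensor_comp f g f' g')).trans ?_
      exact ((congrArg₂ _ (mk_comp f g) (mk_comp f' g')).trans (mk_tensor _ _)).symm)
    (associator_naturality := fun φ φ' φ'' => by
      obtain ⟨X, f, rfl⟩ := exists_mk φ
      obtain ⟨X', f', rfl⟩ := exists_mk φ'
      obtain ⟨X'', f'', rfl⟩ := exists_mk φ''
      rw [mk_tensorHom_mk f f', mk_tensorHom_mk f' f'']
      refine (congrArg₂ _ (mk_tensor (purTensor f f') f'') rfl).trans ?_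
      refine (mk_comp_pure _ _).trans ?_
      refine (mk_eq (purTensor_assoc f f' f'')).trans ?_
      exact ((congrArg₂ _ rfl (mk_tensor f (purTensor f' f''))).trans (pure_comp_mk _ _)).symm)
    (leftUnitor_naturality := fun φ => by
      obtain ⟨X, f, rfl⟩ := exists_mk φ
      refine (congrArg₂ _ ((congrArg₂ tensor (id_eq_pure (𝟙_ (CPM C))) rfl).trans
        (mk_tensor (purePur (𝟙 (𝟙_ C))) f)) rfl).trans ?_
      refine (mk_comp_pure _ _).trans ((mk_eq (purTensor_unit_left f)).trans ?_)
      exact (pure_comp_mk _ _).symm)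
    (rightUnitor_naturality := fun φ => by
      obtain ⟨X, f, rfl⟩ := exists_mk φ
      refine (congrArg₂ _ ((congrArg₂ tensor rfl (id_eq_pure (𝟙_ (CPM C)))).trans
        (mk_tensor f (purePur (𝟙 (𝟙_ C))))) rfl).trans ?_
      refine (mk_comp_pure _ _).trans ((mk_eq (purTensor_unit_right f)).trans ?_)
      exact (pure_comp_mk _ _).symm)
    (pentagon := fun A B D E => by
      simp only [associator_hom', id_eq_pure]
      erw [pure_tensorHom_pure, pure_tensorHom_pure, ← pure_comp, ← pure_comp, ← pure_comp]
      rw [tensorHom_id, id_tensorHom]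
      exact congrArg pure (MonoidalCategory.pentagon A.obj B.obj D.obj E.obj))
    (triangle := fun A B => by
      simp only [associator_hom', leftUnitor_hom', rightUnitor_hom', id_eq_pure]
      erw [pure_tensorHom_pure, pure_tensorHom_pure, ← pure_comp]
      rw [tensorHom_id, id_tensorHom]
      exact congrArg pure (MonoidalCategory.triangle A.obj B.obj))

instance strict : StrictMonoidal (CPM C) where
  tensor_assoc A B D := congrArg CPM.of (StrictMonoidal.tensor_assoc A.obj B.obj D.obj)
  unit_tensor A := congrArg CPM.of (StrictMonoidal.unit_tensor A.obj)
  tensor_unit A := congrArg CPM.of (StrictMonoidal.tensor_unit A.obj)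
  associator_hom A B D := by
    rw [associator_hom', StrictMonoidal.associator_hom, pure_eqToHom]
  leftUnitor_hom A := by
    rw [leftUnitor_hom', StrictMonoidal.leftUnitor_hom, pure_eqToHom]
  rightUnitor_hom A := by
    rw [rightUnitor_hom', StrictMonoidal.rightUnitor_hom, pure_eqToHom]

noncomputable instance symmetric : SymmetricCategory (CPM C) where
  braiding A B := pureIso (β_ A.obj B.obj)
  braiding_naturality_right A B B' φ := by
    obtain ⟨X, f, rfl⟩ := exists_mk φ
    refine (congrArg₂ _ ((congrArg₂ tensor (id_eq_pure A) rfl).trans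
      (mk_tensor (purePur (𝟙 A.obj)) f)) rfl).trans ?_
    refine (mk_comp_pure _ _).trans ((mk_eq (purTensor_braiding _ _)).trans ?_)
    exact ((congrArg₂ _ rfl ((congrArg₂ tensor rfl (id_eq_pure A)).trans
      (mk_tensor f (purePur (𝟙 A.obj))))).trans (pure_comp_mk _ _)).symm
  braiding_naturality_left φ A := by
    obtain ⟨X, f, rfl⟩ := exists_mk φ
    refine (congrArg₂ _ ((congrArg₂ tensor rfl (id_eq_pure A)).trans
      (mk_tensor f (purePur (𝟙 A.obj)))) rfl).trans ?_
    refine (mk_comp_pure _ _).trans ((mk_eq (purTensor_braiding _ _)).trans ?_)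
    exact ((congrArg₂ _ rfl ((congrArg₂ tensor (id_eq_pure A) rfl).trans
      (mk_tensor (purePur (𝟙 A.obj)) f))).trans (pure_comp_mk _ _)).symm
  hexagon_forward A B D := by
    have h := congrArg pure (BraidedCategory.hexagon_forward A.obj B.obj D.obj)
    simp only [pure_comp, ← tensorHom_id, ← id_tensorHom, ← pure_tensorHom_pure, pure_id] at h
    simp only [← tensorHom_id, ← id_tensorHom]
    exact h
  hexagon_reverse A B D := by
    have h := congrArg pure (BraidedCategory.hexagon_reverse A.obj B.obj D.obj)
    simp only [pure_comp, ← tensorHom_id, ← id_tensorHom, ← pure_tensorHom_pure, pure_id] at h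
    simp only [← tensorHom_id, ← id_tensorHom]
    exact h
  symmetry A B := by
    have h := congrArg pure (SymmetricCategory.symmetry A.obj B.obj)
    simp only [pure_comp, pure_id] at h
    exact h

/-- The discard morphism `A ⟶ I` of `CPM(C)`: its purification is the identity of `A`, seen as a
morphism `A ⟶ I ⊗ A`. -/
def discard (A : C) : (⟨A⟩ : CPM C) ⟶ ⟨𝟙_ C⟩ :=
  mk (λ_ A).inv

theorem tensorPow_eq (X : C) (n : ℕ) :
    tensorPow (⟨X⟩ : CPM C) n = ⟨tensorPow X n⟩ := by
  induction n with
  | zero => rfl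
  | succ n ih =>
    change tensorPow (⟨X⟩ : CPM C) n ⊗ ⟨X⟩ = _
    rw [ih]; rfl

end CPM

/-- An interpretation of the generators of a presentation in a strict symmetric monoidal category:
an object for the wire, and a morphism for each generator. -/
structure Interpretation (P : PropPresentation.{w}) (C : Type u) [Category.{v} C]
    [MonoidalCategory C] where
  /-- the interpretation of the wire -/
  wire : C
  /-- the interpretation of the generators -/
  gen : ∀ n m : ℕ, P.Gen n m → (tensorPow wire n ⟶ tensorPow wire m)

namespace Interpretation

section Semantics

variable {P : PropPresentation.{w}} {C : Type u} [Category.{v} C] [MonoidalCategory C]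
  [SymmetricCategory C] [StrictMonoidal C]

/-- Soundness: the equations of the presentation hold in the interpretation. -/
def Sound (J : Interpretation P C) : Prop :=
  ∀ (n m : ℕ) (f g : Diagram P.Gen n m), P.Eqn n m f g →
    f.eval J.wire J.gen = g.eval J.wire J.gen

/-- The interpretation functor of a sound interpretation. -/
def functor (J : Interpretation P C) (hJ : J.Sound) : P.Carrier ⥤ C where
  obj A := tensorPow J.wire A.width
  map f := Quotient.lift (fun d => d.eval J.wire J.gen)
    (fun _ _ h => Diagram.eval_eq_of_equiv J.wire J.gen hJ h) f
  map_id _ := rfl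
  map_comp f g := by
    obtain ⟨f, rfl⟩ := P.hom_surjective f
    obtain ⟨g, rfl⟩ := P.hom_surjective g
    rfl

/-- Universality: the interpretation functor is surjective, on objects and on each hom-set. -/
def IsUniversal (J : Interpretation P C) (hJ : J.Sound) : Prop :=
  Function.Surjective (J.functor hJ).obj ∧ (J.functor hJ).Full

/-- Completeness: the interpretation functor is faithful. -/
def IsComplete (J : Interpretation P C) (hJ : J.Sound) : Prop :=
  (J.functor hJ).Faithful

/-- The interpretation functor preserves the dagger. -/
def PreservesDagger [DaggerSymmetric P.Carrier] [DaggerSymmetric C] (J : Interpretation P C)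
    (hJ : J.Sound) : Prop :=
  ∀ (A B : P.Carrier) (f : A ⟶ B), (J.functor hJ).map (dagger f) = dagger ((J.functor hJ).map f)

end Semantics

end Interpretation

/-- The generators `Gen` together with a discard generator `1 ⟶ 0`. -/
inductive GroundGen (Gen : ℕ → ℕ → Type w) : ℕ → ℕ → Type w
  | base {n m : ℕ} (s : Gen n m) : GroundGen Gen n m
  | discard : GroundGen Gen 1 0

namespace Diagram

/-- A diagram over `Gen`, seen as a diagram with discards. -/
def toGround {Gen : ℕ → ℕ → Type w} :
    ∀ {n m : ℕ}, Diagram Gen n m → Diagram (GroundGen Gen) n m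
  | _, _, gen s => gen (GroundGen.base s)
  | _, _, id n => id n
  | _, _, comp f g => comp (toGround f) (toGround g)
  | _, _, tensor f g => tensor (toGround f) (toGround g)
  | _, _, swap n m => swap n m

/-- The tensor product of `n` copies of the discard generator. -/
def discards {Gen : ℕ → ℕ → Type w} : ∀ n : ℕ, Diagram (GroundGen Gen) n 0
  | 0 => id 0
  | n + 1 => tensor (discards n) (gen GroundGen.discard)

end Diagram

namespace PropPresentation

/-- The equations of `P`, and one equation `discard ∘ D = discard` for each isometry `D` of the
presented prop. -/
inductive GroundEqn (P : PropPresentation.{w}) [DaggerSymmetric P.Carrier] :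
    ∀ n m : ℕ, Diagram (GroundGen P.Gen) n m → Diagram (GroundGen P.Gen) n m → Prop
  | base {n m : ℕ} {f g : Diagram P.Gen n m} (h : P.Eqn n m f g) :
      GroundEqn P n m f.toGround g.toGround
  | discard {n m : ℕ} (D : Diagram P.Gen n m) (h : IsIsometry (P.hom D)) :
      GroundEqn P n 0 (D.toGround.comp (Diagram.discards m)) (Diagram.discards n)

/-- The extension of a language by a discard map that deletes isometries. -/
def ground (P : PropPresentation.{w}) [DaggerSymmetric P.Carrier] : PropPresentation.{w} where
  Gen := GroundGen P.Gen
  Eqn := GroundEqn P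

end PropPresentation

/-- The interpretation in `CPM(C)` of the language with discards: a generator of the original
language is interpreted as before, as a pure morphism, and the discard generator as the discard
morphism of the wire. -/
noncomputable def Interpretation.ground {P : PropPresentation.{w}} [DaggerSymmetric P.Carrier]
    {C : Type u} [Category.{v} C] [MonoidalCategory C] [SymmetricCategory C] [StrictMonoidal C]
    [DaggerCompact C] (J : Interpretation P C) : Interpretation P.ground (CPM C) where
  wire := ⟨J.wire⟩
  gen _ _ s :=
    match s with
    | GroundGen.base (n := n) (m := m) s =>
      eqToHom (CPM.tensorPow_eq J.wire n) ≫ CPM.pure (J.gen n m s) ≫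
        eqToHom (CPM.tensorPow_eq J.wire m).symm
    | GroundGen.discard =>
      eqToHom (tensorPow_one (⟨J.wire⟩ : CPM C)) ≫ CPM.discard J.wire

/-! By construction of CPM(C), a morphism `A ⟶ B` is a morphism `f : A ⟶ B ⊗ X` of C whose ancilla X
is discarded. The language with discards has the same shape: every diagram with discards equals a
discard-free diagram `A ⟶ B ⊗ X` followed by a discard of X (`exists_discardAncilla`). Discards
slide past everything to the right-hand end of the outputs and collect there, because discarding is
multiplicative on wires (`PropPresentation.discard_tensor`). The interpretation sends the diagram
with purification f to the completely positive map with purification ⟦f⟧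
(`ground_functor_map_discardAncilla`).

The three claims follow from this dictionary. Soundness: an isometry D is sent to an isometry, since
the dagger is preserved, and an isometry on the ancilla does not change a completely positive map
(`CPM.pure_comp_discard`). Universality: every purification in C is the image of one in the
language, as the original functor is surjective on objects and full (`exists_purification`).

Completeness: let two normal forms f and g have the same image. Then ⟦f⟧ and ⟦g⟧ are related by
∼_cp, by the snake equations (`cpMap_eq_iff_cpEnd_eq`), hence by a finite chain of ∼_iso, as C has
enough isometries. The whole chain lifts to the language: intermediate purifications and isometries
by universality, the property of being an isometry and the equations by faithfulness. Each lifted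
link says that two purifications agree after isometries on the ancillas, and the discard deletes
these isometries (`discardAncilla_eq_of_isoRel`). So f and g are equal once their ancillas are
discarded. -/

/-! ### Discard-free diagrams inside the language with discards -/

namespace Diagram

theorem toGround_cast {Gen : ℕ → ℕ → Type w} {n m n' m' : ℕ} (h : n = n') (h' : m = m')
    (f : Diagram Gen n m) : (cast h h' f).toGround = cast h h' f.toGround := by
  subst h; subst h'; rfl

/-- The translation preserves the formal operations, so every prop axiom goes to an instance of
itself, and the equations of `P` are among those of `P.ground`. This makes `inclusion` well defined
on classes of diagrams. -/
theorem Equiv.toGround {P : PropPresentation.{w}} [DaggerSymmetric P.Carrier] {n m : ℕ}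
    {f g : Diagram P.Gen n m} (h : Equiv P.Eqn f g) :
    Equiv P.ground.Eqn f.toGround g.toGround := by
  induction h with
  | eqn h => exact .eqn (.base h)
  | refl f => exact .refl _
  | symm _ ih => exact .symm ih
  | trans _ _ ih ih' => exact .trans ih ih'
  | comp_congr _ _ ih ih' => exact .comp_congr ih ih'
  | tensor_congr _ _ ih ih' => exact .tensor_congr ih ih'
  | id_comp f => exact .id_comp _
  | comp_id f => exact .comp_id _
  | assoc f g h => exact .assoc _ _ _
  | tensor_id n m => exact .tensor_id n m
  | interchange f g f' g' => exact .interchange _ _ _ _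
  | tensor_assoc f g h => rw [toGround_cast]; exact .tensor_assoc _ _ _
  | unit_tensor f => rw [toGround_cast]; exact .unit_tensor _
  | tensor_unit f => rw [toGround_cast]; exact .tensor_unit _
  | swap_naturality f g => exact .swap_naturality _ _
  | swap_swap n m => exact .swap_swap n m
  | swap_unit n => rw [toGround_cast]; exact .swap_unit n
  | swap_add n m k =>
    simp only [Diagram.toGround, toGround_cast]
    exact .swap_add n m k

end Diagram

/-! ### Effects applied to ancillas in a monoidal category -/

section Effects

variable {D : Type u} [Category.{v} D] [MonoidalCategory D]

/-- Naturality of the associator, plus coherence for the unitors on three copies of the unit. It is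
the induction step that makes discards multiplicative. -/
theorem tensorHom_effects_assoc {a b c : D} (f : a ⟶ 𝟙_ D) (g : b ⟶ 𝟙_ D) (h : c ⟶ 𝟙_ D) :
    (((f ⊗ₘ g) ≫ (λ_ (𝟙_ D)).hom) ⊗ₘ h) ≫ (λ_ (𝟙_ D)).hom =
      (α_ a b c).hom ≫ (f ⊗ₘ ((g ⊗ₘ h) ≫ (λ_ (𝟙_ D)).hom)) ≫ (λ_ (𝟙_ D)).hom := by
  have h1 : ((f ⊗ₘ g) ≫ (λ_ (𝟙_ D)).hom) ⊗ₘ h =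
      ((f ⊗ₘ g) ⊗ₘ h) ≫ (λ_ (𝟙_ D)).hom ▷ 𝟙_ D := by
    rw [← tensorHom_id, tensorHom_comp_tensorHom, Category.comp_id]
  have h2 : f ⊗ₘ ((g ⊗ₘ h) ≫ (λ_ (𝟙_ D)).hom) =
      (f ⊗ₘ (g ⊗ₘ h)) ≫ 𝟙_ D ◁ (λ_ (𝟙_ D)).hom := by
    rw [← id_tensorHom, tensorHom_comp_tensorHom, Category.comp_id]
  have h3 : (λ_ (𝟙_ D)).hom ▷ 𝟙_ D =
      (α_ (𝟙_ D) (𝟙_ D) (𝟙_ D)).hom ≫ 𝟙_ D ◁ (λ_ (𝟙_ D)).hom := by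
    monoidal_coherence
  rw [h1, h2, h3, Category.assoc, Category.assoc, Category.assoc, ← associator_naturality_assoc]

/-- Application of an effect to the second output of a morphism. -/
def applyEffect {a b x : D} (f : a ⟶ b ⊗ x) (s : x ⟶ 𝟙_ D) : a ⟶ b :=
  f ≫ b ◁ s ≫ (ρ_ b).hom

/-- By the interchange law the effect `s` can wait until after `g`. Both effects then act at the
end, on `y ⊗ x`, the ancilla of `purComp f g`. -/
theorem applyEffect_comp {a b d x y : D} (f : a ⟶ b ⊗ x) (g : b ⟶ d ⊗ y) (s : x ⟶ 𝟙_ D)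
    (t : y ⟶ 𝟙_ D) :
    applyEffect f s ≫ applyEffect g t =
      applyEffect (purComp f g) ((t ⊗ₘ s) ≫ (λ_ (𝟙_ D)).hom) := by
  have h : b ◁ s ≫ (ρ_ b).hom ≫ g = g ▷ x ≫ (d ⊗ y) ◁ s ≫ (ρ_ (d ⊗ y)).hom := by
    rw [← whisker_exchange_assoc, rightUnitor_naturality]
  have h' : (d ⊗ y) ◁ s ≫ (ρ_ (d ⊗ y)).hom ≫ d ◁ t =
      (α_ d y x).hom ≫ d ◁ ((t ⊗ₘ s) ≫ (λ_ (𝟙_ D)).hom) := by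
    rw [MonoidalCategory.tensorHom_def', Category.assoc, ← unitors_equal.symm,
      rightUnitor_naturality]
    simp
  simp only [applyEffect, purComp, Category.assoc]
  rw [reassoc_of% h, reassoc_of% h']

/-- Naturality of `tensorμ` carries the effects past the exchange of the middle wires; what remains
is the compatibility of the right unitor with tensor products. -/
theorem applyEffect_tensor [SymmetricCategory D] {a b x a' b' x' : D} (f : a ⟶ b ⊗ x)
    (g : a' ⟶ b' ⊗ x') (s : x ⟶ 𝟙_ D) (t : x' ⟶ 𝟙_ D) :
    applyEffect f s ⊗ₘ applyEffect g t =
      applyEffect (purTensor f g) ((s ⊗ₘ t) ≫ (λ_ (𝟙_ D)).hom) := by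
  have hn : (b ◁ s ⊗ₘ b' ◁ t) ≫ tensorμ b (𝟙_ D) b' (𝟙_ D) =
      tensorμ b x b' x' ≫ (b ⊗ b') ◁ (s ⊗ₘ t) := by
    simpa using tensorμ_natural (𝟙 b) s (𝟙 b') t
  have h := rightUnitor_monoidal b b'
  simp only [applyEffect, purTensor, whiskerLeft_comp, Category.assoc]
  rw [← tensorHom_comp_tensorHom, ← tensorHom_comp_tensorHom, h, reassoc_of% hn]

theorem applyEffect_comp_whiskerLeft {a b x z : D} (f : a ⟶ b ⊗ x) (p : x ⟶ z) (s : z ⟶ 𝟙_ D) :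
    applyEffect (f ≫ b ◁ p) s = applyEffect f (p ≫ s) := by
  simp [applyEffect]

theorem applyEffect_leftUnitor_inv {a : D} (s : a ⟶ 𝟙_ D) :
    applyEffect (λ_ a).inv s = s := by
  simp [applyEffect, ← unitors_equal]

theorem applyEffect_purePur {a b : D} (f : a ⟶ b) : applyEffect (purePur f) (𝟙 (𝟙_ D)) = f := by
  simp [applyEffect, purePur]

end Effects

/-! ### Normal form in the language with discards -/

namespace PropPresentation

variable (P : PropPresentation.{w}) [DaggerSymmetric P.Carrier]

/-- The inclusion of a language in its extension by discards. -/
def inclusion : P.Carrier ⥤ P.ground.Carrier where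
  obj A := ⟨A.width⟩
  map f := Quotient.map Diagram.toGround (fun _ _ h => Diagram.Equiv.toGround h) f
  map_id _ := rfl
  map_comp f g := by
    obtain ⟨f, rfl⟩ := P.hom_surjective f
    obtain ⟨g, rfl⟩ := P.hom_surjective g
    rfl

/-- This and the next lemmas say that `inclusion` is a strict symmetric monoidal functor. On
representatives the operations agree by definition; associators and unitors are `eqToHom`s. -/
theorem inclusion_map_tensorHom {A B A' B' : P.Carrier} (f : A ⟶ B) (g : A' ⟶ B') :
    P.inclusion.map (f ⊗ₘ g) = P.inclusion.map f ⊗ₘ P.inclusion.map g := by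
  obtain ⟨f, rfl⟩ := P.hom_surjective f
  obtain ⟨g, rfl⟩ := P.hom_surjective g
  rfl

theorem inclusion_map_whiskerLeft (A : P.Carrier) {B D : P.Carrier} (f : B ⟶ D) :
    P.inclusion.map (A ◁ f) = P.inclusion.obj A ◁ P.inclusion.map f := by
  obtain ⟨f, rfl⟩ := P.hom_surjective f
  rfl

theorem inclusion_map_whiskerRight {B D : P.Carrier} (f : B ⟶ D) (A : P.Carrier) :
    P.inclusion.map (f ▷ A) = P.inclusion.map f ▷ P.inclusion.obj A := by
  obtain ⟨f, rfl⟩ := P.hom_surjective f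
  rfl

theorem inclusion_map_associator_hom (A B D : P.Carrier) :
    P.inclusion.map (α_ A B D).hom =
      (α_ (P.inclusion.obj A) (P.inclusion.obj B) (P.inclusion.obj D)).hom := by
  rw [associator_hom', eqToHom_map]; rfl

theorem inclusion_map_associator_inv (A B D : P.Carrier) :
    P.inclusion.map (α_ A B D).inv =
      (α_ (P.inclusion.obj A) (P.inclusion.obj B) (P.inclusion.obj D)).inv := by
  rw [StrictMonoidal.associator_inv, eqToHom_map]; rfl

theorem inclusion_map_leftUnitor_inv (A : P.Carrier) :
    P.inclusion.map (λ_ A).inv = (λ_ (P.inclusion.obj A)).inv := by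
  rw [StrictMonoidal.leftUnitor_inv, eqToHom_map]; rfl

theorem inclusion_map_rightUnitor_inv (A : P.Carrier) :
    P.inclusion.map (ρ_ A).inv = (ρ_ (P.inclusion.obj A)).inv := by
  rw [StrictMonoidal.rightUnitor_inv, eqToHom_map]; rfl

theorem inclusion_map_braiding (A B : P.Carrier) :
    P.inclusion.map (β_ A B).hom = (β_ (P.inclusion.obj A) (P.inclusion.obj B)).hom :=
  rfl

theorem inclusion_map_tensorμ (A B A' B' : P.Carrier) :
    P.inclusion.map (tensorμ A B A' B') =
      tensorμ (P.inclusion.obj A) (P.inclusion.obj B) (P.inclusion.obj A')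
        (P.inclusion.obj B') := by
  simp only [tensorμ, Functor.map_comp, inclusion_map_whiskerLeft, inclusion_map_whiskerRight,
    inclusion_map_associator_hom, inclusion_map_associator_inv, inclusion_map_braiding]
  rfl

/-- The discard morphism on any number of wires. -/
def discard (A : P.Carrier) : P.inclusion.obj A ⟶ 𝟙_ P.ground.Carrier :=
  P.ground.hom (Diagram.discards A.width)

theorem discard_unit : P.discard (𝟙_ P.Carrier) = 𝟙 (𝟙_ P.ground.Carrier) :=
  rfl

/-- Here the added equations enter the language with discards; completeness rests on them through
this lemma. -/
theorem inclusion_map_comp_discard {A B : P.Carrier} (f : A ⟶ B) (hf : IsIsometry f) :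
    P.inclusion.map f ≫ P.discard B = P.discard A := by
  obtain ⟨d, rfl⟩ := P.hom_surjective f
  exact P.ground.hom_eq (.eqn (.discard d hf))

/-- The tensor of the two effects ends in `0 + 0` wires, which is `0` by computation, so the left
unitor is definitionally an identity. -/
theorem discard_succ (n : ℕ) :
    P.discard ⟨n + 1⟩ = (P.discard ⟨n⟩ ⊗ₘ P.ground.hom (.gen GroundGen.discard)) ≫
      (λ_ (𝟙_ P.ground.Carrier)).hom :=
  (Category.comp_id _).symm

/-- Induction on the second factor, because `discards` adds its wires on the right. -/
theorem discard_tensor (A B : P.Carrier) :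
    P.discard (A ⊗ B) = (P.discard A ⊗ₘ P.discard B) ≫ (λ_ (𝟙_ P.ground.Carrier)).hom := by
  obtain ⟨m⟩ := B
  induction m with
  | zero =>
    have h := rightUnitor_naturality (P.discard A)
    rw [← tensorHom_id, ← unitors_equal] at h
    refine Eq.trans ?_ h.symm
    exact (Category.id_comp _).symm
  | succ m ih =>
    have h := tensorHom_effects_assoc (P.discard A) (P.discard ⟨m⟩)
      (P.ground.hom (.gen GroundGen.discard))
    rw [discard_succ]
    -- `A.width + (m + 1)` and `(A.width + m) + 1` agree by computation, so the associator in `h` is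
    -- an identity.
    refine ((P.discard_succ (A.width + m)).trans ?_).trans (h.trans (Category.id_comp _))
    exact congrArg (fun k => (k ⊗ₘ P.ground.hom (.gen GroundGen.discard)) ≫
      (λ_ (𝟙_ P.ground.Carrier)).hom) ih

/-- The morphism with discards obtained by discarding the ancilla of a purification. -/
def discardAncilla {A B X : P.Carrier} (f : A ⟶ B ⊗ X) : P.inclusion.obj A ⟶ P.inclusion.obj B :=
  applyEffect (b := P.inclusion.obj B) (x := P.inclusion.obj X) (P.inclusion.map f) (P.discard X)

theorem discardAncilla_comp_isometry {A B X Z : P.Carrier} (f : A ⟶ B ⊗ X) (p : X ⟶ Z)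
    (hp : IsIsometry p) : P.discardAncilla (f ≫ B ◁ p) = P.discardAncilla f := by
  have h := (P.inclusion.map_comp f (B ◁ p)).trans
    (congrArg₂ (· ≫ ·) rfl (P.inclusion_map_whiskerLeft B p))
  refine (congrArg (fun k => applyEffect (D := P.ground.Carrier) k (P.discard Z)) h).trans ?_
  refine (applyEffect_comp_whiskerLeft (D := P.ground.Carrier) (b := P.inclusion.obj B)
    (P.inclusion.map f) (P.inclusion.map p) (P.discard Z)).trans ?_
  rw [P.inclusion_map_comp_discard p hp]
  rfl

theorem discardAncilla_purePur {A B : P.Carrier} (f : A ⟶ B) :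
    P.discardAncilla (purePur f) = P.inclusion.map f := by
  have h := (P.inclusion.map_comp f (ρ_ B).inv).trans
    (congrArg₂ (· ≫ ·) rfl (P.inclusion_map_rightUnitor_inv B))
  refine (congrArg (fun k => applyEffect (D := P.ground.Carrier) k
    (P.discard (𝟙_ P.Carrier))) h).trans ?_
  exact applyEffect_purePur _

theorem discardAncilla_leftUnitor_inv (A : P.Carrier) :
    P.discardAncilla (λ_ A).inv = P.discard A :=
  (congrArg (fun k => applyEffect (D := P.ground.Carrier) k (P.discard A))
    (P.inclusion_map_leftUnitor_inv A)).trans (applyEffect_leftUnitor_inv _)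

/-- Together with `discardAncilla_tensor`, this shows that normal forms are closed under the
operations of a prop. -/
theorem discardAncilla_comp {A B D X Y : P.Carrier} (f : A ⟶ B ⊗ X) (g : B ⟶ D ⊗ Y) :
    P.discardAncilla f ≫ P.discardAncilla g = P.discardAncilla (purComp f g) := by
  have h := (P.inclusion.map_comp f (g ▷ X ≫ (α_ D Y X).hom)).trans (congrArg₂ (· ≫ ·) rfl
    ((P.inclusion.map_comp (g ▷ X) (α_ D Y X).hom).trans
      (congrArg₂ (· ≫ ·) (P.inclusion_map_whiskerRight g X) (P.inclusion_map_associator_hom D Y X))))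
  refine (applyEffect_comp _ _ _ _).trans ?_
  exact congrArg₂ (applyEffect (D := P.ground.Carrier)) h.symm (P.discard_tensor Y X).symm

theorem discardAncilla_tensor {A B X A' B' X' : P.Carrier} (f : A ⟶ B ⊗ X)
    (g : A' ⟶ B' ⊗ X') :
    P.discardAncilla f ⊗ₘ P.discardAncilla g = P.discardAncilla (purTensor f g) := by
  have h := (P.inclusion.map_comp (f ⊗ₘ g) (tensorμ B X B' X')).trans
    (congrArg₂ (· ≫ ·) (P.inclusion_map_tensorHom f g) (P.inclusion_map_tensorμ B X B' X'))
  refine (applyEffect_tensor _ _ _ _).trans ?_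
  exact congrArg₂ (applyEffect (D := P.ground.Carrier)) h.symm (P.discard_tensor X X').symm

/-- Induction on the diagram. Original generators, identities and swaps have the trivial ancilla,
the discard generator has its own input wire as ancilla, and composition and tensor collect the
ancillas of the parts. -/
theorem exists_discardAncilla {A B : P.Carrier} (f : P.inclusion.obj A ⟶ P.inclusion.obj B) :
    ∃ (X : P.Carrier) (g : A ⟶ B ⊗ X), f = P.discardAncilla g := by
  obtain ⟨d, rfl⟩ := P.ground.hom_surjective f
  have key : ∀ {n m : ℕ} (d : Diagram P.ground.Gen n m), ∃ (X : P.Carrier)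
      (g : (⟨n⟩ : P.Carrier) ⟶ ⟨m⟩ ⊗ X), P.ground.hom d = P.discardAncilla g := by
    intro n m d
    induction d with
    | gen s =>
      cases s with
      | base s => exact ⟨_, _, (P.discardAncilla_purePur (P.hom (.gen s))).symm⟩
      | discard =>
        refine ⟨_, _, Eq.trans ?_ (P.discardAncilla_leftUnitor_inv ⟨1⟩).symm⟩
        -- `discards 1` is not the bare generator but its tensor with the empty diagram, which the
        -- left unitor removes.
        have h := leftUnitor_naturality (P.ground.hom (.gen GroundGen.discard))
        rw [← id_tensorHom] at h
        refine (Category.id_comp _).symm.trans (h.symm.trans ?_)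
        exact Category.comp_id _
    | id n => exact ⟨_, _, (P.discardAncilla_purePur (P.hom (.id n))).symm⟩
    | comp f g ihf ihg =>
      obtain ⟨X, f', hf⟩ := ihf
      obtain ⟨Y, g', hg⟩ := ihg
      exact ⟨_, _, (congrArg₂ _ hf hg).trans (P.discardAncilla_comp f' g')⟩
    | tensor f g ihf ihg =>
      obtain ⟨X, f', hf⟩ := ihf
      obtain ⟨Y, g', hg⟩ := ihg
      exact ⟨_, _, (congrArg₂ (· ⊗ₘ ·) hf hg).trans (P.discardAncilla_tensor f' g')⟩
    | swap n m => exact ⟨_, _, (P.discardAncilla_purePur (P.hom (.swap n m))).symm⟩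
  exact key d

end PropPresentation

/-! ### Discarding in CPM(C) -/

namespace CPM

variable {C : Type u} [Category.{v} C] [MonoidalCategory C] [SymmetricCategory C]
  [StrictMonoidal C] [DaggerCompact C]

/-- The purification of a discard is all ancilla, so `p` acts on the ancilla only and cancels
against its dagger when the wires are joined. -/
theorem pure_comp_discard {A B : C} (p : A ⟶ B) (hp : IsIsometry p) :
    pure p ≫ discard B = discard A := by
  rw [discard, pure_comp_mk]
  refine mk_eq ?_
  rw [leftUnitor_inv_naturality, cpMap_comp_isometry _ _ hp]

/-- This identifies the abstract presentation of a map by a purification with an actual composite in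
CPM(C), which is the form that the diagrams with discards take. -/
theorem applyEffect_pure_discard {A B X : C} (f : A ⟶ B ⊗ X) :
    applyEffect (D := CPM C) (b := ⟨B⟩) (x := ⟨X⟩) (pure f) (discard X) = mk f := by
  have h : (⟨B⟩ : CPM C) ◁ discard X = mk (purTensor (purePur (𝟙 B)) (λ_ X).inv) :=
    (congrArg₂ tensor (id_eq_pure ⟨B⟩) rfl).trans (mk_tensor (purePur (𝟙 B)) (λ_ X).inv)
  refine (congrArg (fun k => pure f ≫ k ≫ pure (ρ_ B).hom) h).trans ?_
  refine (congrArg (fun k => pure f ≫ k) (mk_comp_pure _ _)).trans ?_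
  refine (pure_comp_mk _ _).trans (mk_eq ?_)
  -- The composite has ancilla `𝟙_ C ⊗ X` instead of `X`; the left unitor is an isometry, so the two
  -- give the same map.
  rw [← cpMap_comp_isometry _ _ (isIsometry_leftUnitor X)]
  congr 1
  -- The middle wires that `tensorμ` exchanges are both the unit, whose braiding with itself is the
  -- identity.
  have hμ : tensorμ B (𝟙_ C) (𝟙_ C) X = 𝟙 _ := by
    have hβ : (β_ (𝟙_ C) (𝟙_ C)).hom = 𝟙 _ := by
      rw [braiding_tensorUnit_right, ← unitors_equal, Iso.hom_inv_id]
    rw [tensorμ, hβ]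
    simp
  have h' : ((ρ_ B).inv ⊗ₘ (λ_ X).inv) ≫ (ρ_ B).hom ▷ (𝟙_ C ⊗ X) ≫ B ◁ (λ_ X).hom = 𝟙 _ := by
    rw [← MonoidalCategory.tensorHom_def, tensorHom_comp_tensorHom, Iso.inv_hom_id,
      Iso.inv_hom_id, id_tensorHom_id]
  simp only [purTensor, purePur, Category.id_comp, hμ, Category.assoc]
  rw [h', Category.comp_id]

theorem discard_tensor (A B : C) :
    discard (A ⊗ B) = (discard A ⊗ₘ discard B) ≫ (λ_ (𝟙_ (CPM C))).hom := by
  refine Eq.symm ((congrArg (fun k => k ≫ pure (λ_ (𝟙_ C)).hom) (mk_tensor _ _)).trans ?_)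
  refine (mk_comp_pure _ _).trans (mk_eq ?_)
  congr 1
  have h : tensorμ (𝟙_ C) A (𝟙_ C) B ≫ (λ_ (𝟙_ C)).hom ▷ (A ⊗ B) =
      ((λ_ A).hom ⊗ₘ (λ_ B).hom) ≫ (λ_ (A ⊗ B)).inv := by
    rw [leftUnitor_monoidal]; simp
  rw [purTensor, Category.assoc, h, tensorHom_comp_tensorHom_assoc]
  simp

theorem discard_unit : discard (𝟙_ C) = 𝟙 (𝟙_ (CPM C)) := by
  refine Eq.trans ?_ (pure_id (𝟙_ C))
  rw [discard, unitors_inv_equal, pure, purePur, Category.id_comp]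

end CPM

/-! ### Purifications in the language and in C -/

namespace Interpretation

section Purifications

variable {P : PropPresentation.{w}} {C : Type u} [Category.{v} C] [MonoidalCategory C]
  [SymmetricCategory C] [StrictMonoidal C] (J : Interpretation P C)

theorem functor_obj_tensor (hs : J.Sound) (A B : P.Carrier) :
    (J.functor hs).obj (A ⊗ B) = (J.functor hs).obj A ⊗ (J.functor hs).obj B :=
  tensorPow_add J.wire A.width B.width

/-- The purification in `C` that interprets a purification of the language. -/
def purification (hs : J.Sound) {A B X : P.Carrier} (f : A ⟶ B ⊗ X) :
    (J.functor hs).obj A ⟶ (J.functor hs).obj B ⊗ (J.functor hs).obj X :=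
  (J.functor hs).map f ≫ eqToHom (J.functor_obj_tensor hs B X)

theorem functor_map_whiskerLeft (hs : J.Sound) (B : P.Carrier) {X Z : P.Carrier} (p : X ⟶ Z) :
    (J.functor hs).map (B ◁ p) =
      eqToHom (J.functor_obj_tensor hs B X) ≫ (J.functor hs).obj B ◁ (J.functor hs).map p ≫
        eqToHom (J.functor_obj_tensor hs B Z).symm := by
  obtain ⟨d, rfl⟩ := P.hom_surjective p
  rw [← id_tensorHom ((J.functor hs).obj B)]
  rfl

theorem purification_comp_whiskerLeft (hs : J.Sound) {A B X Z : P.Carrier} (f : A ⟶ B ⊗ X)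
    (p : X ⟶ Z) : J.purification hs (f ≫ B ◁ p) =
      J.purification hs f ≫ (J.functor hs).obj B ◁ (J.functor hs).map p := by
  simp [purification, functor_map_whiskerLeft]

theorem purification_injective (hs : J.Sound) (hc : J.IsComplete hs) {A B X : P.Carrier}
    {f g : A ⟶ B ⊗ X} (h : J.purification hs f = J.purification hs g) : f = g :=
  hc.map_injective ((cancel_mono _).1 h)

/-- Surjectivity on objects provides the ancilla, fullness the morphism. -/
theorem exists_purification (hs : J.Sound) (hu : J.IsUniversal hs) (A B : P.Carrier)
    (p : Purification ((J.functor hs).obj A) ((J.functor hs).obj B)) :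
    ∃ (X : P.Carrier) (f : A ⟶ B ⊗ X), p = ⟨(J.functor hs).obj X, J.purification hs f⟩ := by
  obtain ⟨Y, g⟩ := p
  obtain ⟨X, rfl⟩ := hu.1 Y
  obtain ⟨f, hf⟩ := hu.2.map_surjective (g ≫ eqToHom (J.functor_obj_tensor hs B X).symm)
  have h : J.purification hs f = g := by
    simp [purification, hf]
  exact ⟨X, f, by rw [h]⟩

end Purifications

/-! ### The interpretation in CPM(C) and its soundness -/

section Ground

variable {P : PropPresentation.{w}} [DaggerSymmetric P.Carrier]
    {C : Type u} [Category.{v} C] [MonoidalCategory C] [SymmetricCategory C] [StrictMonoidal C]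
    [DaggerCompact C] (J : Interpretation P C)

theorem tensorPow_ground_wire (n : ℕ) :
    tensorPow J.ground.wire n = ⟨tensorPow J.wire n⟩ :=
  CPM.tensorPow_eq J.wire n

theorem eval_toGround {n m : ℕ} (d : Diagram P.Gen n m) :
    d.toGround.eval J.ground.wire J.ground.gen =
      eqToHom (J.tensorPow_ground_wire n) ≫ CPM.pure (d.eval J.wire J.gen) ≫
        eqToHom (J.tensorPow_ground_wire m).symm := by
  -- Powers of the wire in CPM(C) and in C agree only by an induction. With variables in place of
  -- the powers, the equalities can be eliminated by substitution.
  have key : ∀ {Q Q' : CPM C} {A A' : C} (h : Q = ⟨A⟩) (h' : Q' = ⟨A'⟩) {R R' : CPM C} {B B' : C}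
      (g : R = ⟨B⟩) (g' : R' = ⟨B'⟩) (f : A ⟶ B) (f' : A' ⟶ B'),
      (eqToHom h ≫ CPM.pure f ≫ eqToHom g.symm) ⊗ₘ (eqToHom h' ≫ CPM.pure f' ≫ eqToHom g'.symm) =
      eqToHom (show Q ⊗ Q' = ⟨A ⊗ A'⟩ by rw [h, h']; rfl) ≫ CPM.pure (f ⊗ₘ f') ≫
        eqToHom (show ⟨B ⊗ B'⟩ = R ⊗ R' by rw [g, g']; rfl) := by
    intro Q Q' A A' h h' R R' B B' g g' f f'
    subst h h' g g'
    simp [CPM.pure_tensorHom_pure]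
  have keyβ : ∀ {Q Q' : CPM C} {A A' : C} (h : Q = ⟨A⟩) (h' : Q' = ⟨A'⟩),
      (β_ Q Q').hom = eqToHom (show Q ⊗ Q' = ⟨A ⊗ A'⟩ by rw [h, h']; rfl) ≫
        CPM.pure (β_ A A').hom ≫ eqToHom (show ⟨A' ⊗ A⟩ = Q' ⊗ Q by rw [h, h']; rfl) := by
    intro Q Q' A A' h h'
    subst h h'
    simp; rfl
  induction d with
  | gen s => rfl
  | id n => simp [Diagram.toGround, Diagram.eval, CPM.pure_id]
  | comp f g ihf ihg => simp [Diagram.toGround, Diagram.eval, ihf, ihg, CPM.pure_comp]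
  | tensor f g ihf ihg =>
    simp only [Diagram.toGround, Diagram.eval, ihf, ihg]
    rw [key (J.tensorPow_ground_wire _) (J.tensorPow_ground_wire _)
      (J.tensorPow_ground_wire _) (J.tensorPow_ground_wire _)]
    simp only [CPM.pure_comp, CPM.pure_eqToHom,
      Category.assoc, eqToHom_trans, eqToHom_trans_assoc]
  | swap n m =>
    simp only [Diagram.toGround, Diagram.eval, CPM.pure_comp, CPM.pure_eqToHom,
      Category.assoc, eqToHom_trans, eqToHom_trans_assoc]
    rw [keyβ (J.tensorPow_ground_wire n) (J.tensorPow_ground_wire m)]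
    simp

theorem eval_discards (n : ℕ) :
    (Diagram.discards n : Diagram P.ground.Gen n 0).eval J.ground.wire J.ground.gen =
      eqToHom (J.tensorPow_ground_wire n) ≫ CPM.discard (tensorPow J.wire n) ≫
        eqToHom (show (⟨𝟙_ C⟩ : CPM C) = tensorPow J.ground.wire 0 from rfl) := by
  induction n with
  | zero =>
    refine Eq.trans ?_ (Category.id_comp _).symm
    refine Eq.trans ?_ (Category.comp_id _).symm
    exact CPM.discard_unit.symm
  | succ n ih =>
    have key : ∀ {Q Q' R R' : CPM C} {A A' : C} (h : Q = ⟨A⟩) (h' : Q' = ⟨A'⟩)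
        (g : ⟨𝟙_ C⟩ = R) (g' : ⟨𝟙_ C⟩ = R'),
        ((eqToHom h ≫ CPM.discard A ≫ eqToHom g) ⊗ₘ
          (eqToHom h' ≫ CPM.discard A' ≫ eqToHom g')) =
        eqToHom (show Q ⊗ Q' = ⟨A ⊗ A'⟩ by rw [h, h']; rfl) ≫ CPM.discard (A ⊗ A') ≫
          eqToHom (show ⟨𝟙_ C⟩ = R ⊗ R' by
            rw [← g, ← g']; exact (StrictMonoidal.unit_tensor (𝟙_ (CPM C))).symm) := by
      intro Q Q' R R' A A' h h' g g'
      subst h h' g g'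
      rw [CPM.discard_tensor]
      have := StrictMonoidal.leftUnitor_hom (𝟙_ (CPM C))
      rw [this]
      simp
    have h := key (J.tensorPow_ground_wire n) (tensorPow_one J.ground.wire)
      (show (⟨𝟙_ C⟩ : CPM C) = tensorPow J.ground.wire 0 from rfl)
      (show (⟨𝟙_ C⟩ : CPM C) = tensorPow J.ground.wire 0 from rfl)
    have h0 : (Diagram.gen GroundGen.discard : Diagram P.ground.Gen 1 0).eval J.ground.wire
        J.ground.gen = eqToHom (tensorPow_one J.ground.wire) ≫ CPM.discard J.wire ≫
          eqToHom (show (⟨𝟙_ C⟩ : CPM C) = tensorPow J.ground.wire 0 from rfl) :=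
      congrArg (fun k => eqToHom (tensorPow_one J.ground.wire) ≫ k) (Category.comp_id _).symm
    rw [← ih] at h
    refine (congrArg (fun k => eqToHom (tensorPow_add J.ground.wire n 1) ≫ k ≫
      eqToHom (tensorPow_add J.ground.wire 0 0).symm)
      ((congrArg₂ (· ⊗ₘ ·) rfl h0).trans h)).trans ?_
    simp only [Category.assoc, eqToHom_trans, eqToHom_trans_assoc]
    rfl

theorem ground_sound (hs : J.Sound) (hd : J.PreservesDagger hs) : J.ground.Sound := by
  intro n m f g h
  cases h with
  | base h => rw [eval_toGround, eval_toGround, hs _ _ _ _ h]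
  | discard D h => 
    -- A functor that preserves daggers preserves isometries.
    have hi : IsIsometry (D.eval J.wire J.gen) := by
      have h1 := congrArg (J.functor hs).map h
      rw [Functor.map_comp, hd] at h1
      exact h1
    change D.toGround.eval J.ground.wire J.ground.gen ≫ Diagram.eval J.ground.wire J.ground.gen (Diagram.discards _) = _
    rw [eval_toGround, eval_discards, eval_discards, ← CPM.pure_comp_discard _ hi]
    simp

/-- The bridge between syntax and semantics: on both sides the ancilla of a purification is
discarded, and the interpretation respects pure diagrams and discards separately. -/
theorem ground_functor_map_discardAncilla (hs : J.Sound) (hs' : J.ground.Sound)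
    {A B X : P.Carrier} (f : A ⟶ B ⊗ X) :
    (J.ground.functor hs').map (P.discardAncilla f) =
      eqToHom (J.tensorPow_ground_wire A.width) ≫ CPM.mk (J.purification hs f) ≫
        eqToHom (J.tensorPow_ground_wire B.width).symm := by
  obtain ⟨d, rfl⟩ := P.hom_surjective f
  have key : ∀ {Q Q' R : CPM C} {A A' : C} (h : Q = ⟨A⟩) (h' : Q' = ⟨A'⟩) (g : ⟨𝟙_ C⟩ = R),
      𝟙 Q ⊗ₘ (eqToHom h' ≫ CPM.discard A' ≫ eqToHom g) =
        eqToHom (show Q ⊗ Q' = ⟨A⟩ ⊗ ⟨A'⟩ by rw [h, h']) ≫ (⟨A⟩ : CPM C) ◁ CPM.discard A' ≫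
          eqToHom (show ⟨A⟩ ⊗ ⟨𝟙_ C⟩ = Q ⊗ R by rw [h, g]) := by
    intro Q Q' R A A' h h' g
    subst h h' g
    simp
  -- The final identity is the image of the right unitor, which is trivial in the prop because `n +
  -- 0` is `n` by computation.
  have h : (J.ground.functor hs').map (P.discardAncilla (P.hom d)) =
      d.toGround.eval J.ground.wire J.ground.gen ≫
        (eqToHom (tensorPow_add J.ground.wire B.width X.width) ≫
          (𝟙 (tensorPow J.ground.wire B.width) ⊗ₘ
            (Diagram.discards X.width : Diagram P.ground.Gen X.width 0).eval
              J.ground.wire J.ground.gen) ≫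
          eqToHom (tensorPow_add J.ground.wire B.width 0).symm) ≫ 𝟙 _ := rfl
  change _ = _ ≫ CPM.mk (A := tensorPow J.wire A.width) (B := tensorPow J.wire B.width)
    (X := tensorPow J.wire X.width)
    (d.eval J.wire J.gen ≫ eqToHom (tensorPow_add J.wire B.width X.width)) ≫ _
  rw [h, eval_toGround, eval_discards, key (J.tensorPow_ground_wire B.width),
    ← CPM.applyEffect_pure_discard, CPM.pure_comp, CPM.pure_eqToHom, applyEffect,
    StrictMonoidal.rightUnitor_hom]
  simp only [Category.assoc, eqToHom_trans, eqToHom_trans_assoc, Category.comp_id]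
  refine congrArg (eqToHom (J.tensorPow_ground_wire A.width) ≫ ·) ?_
  refine Eq.trans ?_ (Category.assoc _ _ _).symm
  refine congrArg (CPM.pure (d.eval J.wire J.gen) ≫ ·) ?_
  refine Eq.trans ?_ (Category.assoc _ _ _).symm
  refine congrArg (eqToHom _ ≫ ·) ?_
  refine Eq.trans ?_ (Category.assoc _ _ _).symm
  exact congrArg (_ ≫ ·) (eqToHom_trans _ _).symm

end Ground

end Interpretation

/-! ### Universality and completeness -/

theorem eqToHom_conj_conj {D : Type u} [Category.{v} D] {A A' B B' : D} (h : A = A')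
    (h' : B = B') (φ : A ⟶ B) :
    eqToHom h ≫ (eqToHom h.symm ≫ φ ≫ eqToHom h') ≫ eqToHom h'.symm = φ := by
  subst h h'; simp

theorem eqToHom_conj_injective {D : Type u} [Category.{v} D] {A A' B B' : D} (h : A = A')
    (h' : B' = B) {φ ψ : A' ⟶ B'}
    (e : eqToHom h ≫ φ ≫ eqToHom h' = eqToHom h ≫ ψ ≫ eqToHom h') : φ = ψ := by
  subst h h'; simpa using e

namespace Interpretation

section Completeness

variable {P : PropPresentation.{w}} [DaggerSymmetric P.Carrier]
    {C : Type u} [Category.{v} C] [MonoidalCategory C] [SymmetricCategory C] [StrictMonoidal C]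
    [DaggerCompact C] (J : Interpretation P C)

/-- Being an isometry is an equation between a composite with a dagger and an identity, and a
faithful functor that preserves daggers reflects it. -/
theorem isIsometry_of_functor_map (hs : J.Sound) (hd : J.PreservesDagger hs)
    (hc : J.IsComplete hs) {A B : P.Carrier} {p : A ⟶ B}
    (hp : IsIsometry ((J.functor hs).map p)) : IsIsometry p := by
  refine hc.map_injective ?_
  rw [Functor.map_comp, hd, CategoryTheory.Functor.map_id]
  exact hp

/-- The common target and the two isometries lift to the language by universality. They are
isometries there too, and the equation between the extended purifications holds there by
faithfulness. Discarding then deletes both isometries. -/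
theorem discardAncilla_eq_of_isoRel (hs : J.Sound) (hd : J.PreservesDagger hs)
    (hu : J.IsUniversal hs) (hc : J.IsComplete hs) {A B X Y : P.Carrier} {f : A ⟶ B ⊗ X}
    {g : A ⟶ B ⊗ Y}
    (h : IsoRel (⟨_, J.purification hs f⟩ : Purification _ _) ⟨_, J.purification hs g⟩) :
    P.discardAncilla f = P.discardAncilla g := by
  obtain ⟨W, p, q, hp, hq, hpq⟩ := h
  obtain ⟨Z, rfl⟩ := hu.1 W
  obtain ⟨p, rfl⟩ := hu.2.map_surjective (X := X) (Y := Z) p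
  obtain ⟨q, rfl⟩ := hu.2.map_surjective (X := Y) (Y := Z) q
  rw [← P.discardAncilla_comp_isometry f p (J.isIsometry_of_functor_map hs hd hc hp),
    ← P.discardAncilla_comp_isometry g q (J.isIsometry_of_functor_map hs hd hc hq)]
  congr 1
  apply J.purification_injective hs hc
  rw [purification_comp_whiskerLeft, purification_comp_whiskerLeft]
  exact hpq

theorem discardAncilla_eq_of_transGen (hs : J.Sound) (hd : J.PreservesDagger hs)
    (hu : J.IsUniversal hs) (hc : J.IsComplete hs) {A B X Y : P.Carrier} {f : A ⟶ B ⊗ X}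
    {g : A ⟶ B ⊗ Y}
    (h : Relation.TransGen IsoRel (⟨_, J.purification hs f⟩ : Purification _ _)
      ⟨_, J.purification hs g⟩) :
    P.discardAncilla f = P.discardAncilla g := by
  -- The induction runs over the last purification of the chain, which must be a variable; `g` is
  -- generalised with it.
  generalize hq : (⟨_, J.purification hs g⟩ : Purification _ _) = q at h
  induction h generalizing Y g with
  | single h =>
    subst hq
    exact J.discardAncilla_eq_of_isoRel hs hd hu hc h
  | tail _ h ih =>
    rename_i r _ _
    subst hq
    -- The intermediate purification `r` is given only in C; it must come from the language before
    -- the induction hypothesis applies.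
    obtain ⟨Z, k, hk⟩ := J.exists_purification hs hu A B r
    subst hk
    exact (ih rfl).trans (J.discardAncilla_eq_of_isoRel hs hd hu hc h)

theorem ground_isUniversal (hs : J.Sound) (hu : J.IsUniversal hs) (hs' : J.ground.Sound) :
    J.ground.IsUniversal hs' := by
  refine ⟨fun D => ?_, ⟨fun {A B} φ => ?_⟩⟩
  · obtain ⟨D⟩ := D
    obtain ⟨n, rfl⟩ := hu.1 D
    exact ⟨⟨n.width⟩, J.tensorPow_ground_wire n.width⟩
  · obtain ⟨Y, g, hg⟩ := CPM.exists_mk (eqToHom (J.tensorPow_ground_wire A.width).symm ≫ φ ≫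
      eqToHom (J.tensorPow_ground_wire B.width))
    obtain ⟨X, f, hf⟩ := J.exists_purification hs hu ⟨A.width⟩ ⟨B.width⟩ ⟨Y, g⟩
    cases hf
    refine ⟨P.discardAncilla f, (J.ground_functor_map_discardAncilla hs hs' f).trans ?_⟩
    refine (congrArg (fun k => eqToHom (J.tensorPow_ground_wire A.width) ≫ k ≫
      eqToHom (J.tensorPow_ground_wire B.width).symm) hg.symm).trans ?_
    exact eqToHom_conj_conj (J.tensorPow_ground_wire A.width) (J.tensorPow_ground_wire B.width) φ

/-- Both morphisms are put in normal form. Equality of images is equality of the completely positive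
maps of the two purifications, that is ∼_cp, and enough isometries turn it into a chain that lifts.
-/
theorem ground_isComplete (hC : EnoughIsometries C) (hs : J.Sound) (hd : J.PreservesDagger hs)
    (hu : J.IsUniversal hs) (hc : J.IsComplete hs) (hs' : J.ground.Sound) :
    J.ground.IsComplete hs' := by
  refine ⟨fun {A B} φ ψ h => ?_⟩
  obtain ⟨X, f, rfl⟩ := P.exists_discardAncilla (A := ⟨A.width⟩) (B := ⟨B.width⟩) φ
  obtain ⟨Y, g, rfl⟩ := P.exists_discardAncilla (A := ⟨A.width⟩) (B := ⟨B.width⟩) ψ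
  have h1 := (J.ground_functor_map_discardAncilla hs hs' f).symm.trans
    (h.trans (J.ground_functor_map_discardAncilla hs hs' g))
  have h2 := eqToHom_conj_injective _ _ h1
  exact J.discardAncilla_eq_of_transGen hs hd hu hc
    ((hC _ _ _ _).1 ((cpMap_eq_iff_cpEnd_eq _ _).1 (congrArg Subtype.val h2)))

end Completeness

end Interpretation

theorem mainTheorem3 {C : Type u} [Category.{v} C] [MonoidalCategory C] [SymmetricCategory C]
    [StrictMonoidal C] [DaggerCompact C] (hC : EnoughIsometries C)
    (P : PropPresentation.{w}) [DaggerCompact P.Carrier]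
    (J : Interpretation P C) (hs : J.Sound) (hd : J.PreservesDagger hs)
    (hu : J.IsUniversal hs) (hc : J.IsComplete hs) :
    ∃ hs' : J.ground.Sound, J.ground.IsUniversal hs' ∧ J.ground.IsComplete hs' :=
  ⟨J.ground_sound hs hd, J.ground_isUniversal hs hu _, J.ground_isComplete hC hs hd hu hc _⟩
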